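/- A linking pairing is a symmetric bilinear form $\lambda\colon G\times G\to\mathbb{Q}/\mathbb{Z}$ on a finite abelian group $G$ whose adjoint $G\to\mathrm{Hom}(G,\mathbb{Q}/\mathbb{Z})$ is bijective. The orthogonal sum of $(G,\lambda)$ and $(G',\lambda')$ is the pairing $(\lambda\oplus\lambda')((x,x'),(y,y'))=\lambda(x,y)+\lambda'(x',y')$ on $G\times G'$. An isomorphism of linking pairings is a group isomorphism that preserves the pairings. One says that $\lambda'$ is an orthogonal summand of $\lambda$ if there is a linking pairing $\lambda''$ with $\lambda\cong\lambda'\oplus\lambda''$. Let $(G,\lambda)$ be a linking pairing on a finite abelian $2$-group and let $k\ge 1$. Let $\rho_k(\lambda)$ be the number of summands $\mathbb{Z}/2^k$ in a decomposition of $G$ into cyclic groups. Put $$\Gamma_k(\lambda)=\sum_{x\in G}\exp\bigl(\sqrt{-1}\,\pi\,2^k\lambda(x,x)\bigr).$$ Let $\overline{\mathbb{Z}}_8=\mathbb{Z}/8\cup\{\infty\}$, with $\infty+u=u+\infty=\infty$ for all $u$. If $\Gamma_k(\lambda)=0$, put $\sigma_k(\lambda)=\infty$. Otherwise $\Gamma_k(\lambda)/|\Gamma_k(\lambda)|$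 is an eighth root of unity, and $\sigma_k(\lambda)=n\in\mathbb{Z}/8$ is the class such that $\Gamma_k(\lambda)/|\Gamma_k(\lambda)|=\exp(2\pi\sqrt{-1}\,n/8)$. A tableau is a map $T\colon\mathbb{N}_{\ge1}\to\mathbb{N}\times\overline{\mathbb{Z}}_8$. It is admissible if there is a linking pairing $\mu$ on a finite abelian $2$-group with $T(m)=(\rho_m(\mu),\sigma_m(\mu))$ for all $m\ge1$. **Theorem.** Let $\lambda$ and $\lambda'$ be linking pairings on finite abelian $2$-groups. Then $\lambda'$ is an orthogonal summand of $\lambda$ if and only if the following three conditions hold: 1. $\rho_k(\lambda)\ge\rho_k(\lambda')$ for all $k\ge1$; 2. for all $k\ge1$, if $\sigma_k(\lambda')=\infty$ then $\sigma_k(\lambda)=\infty$; 3. some tableau in $S_{\lambda,\lambda'}$ is admissible. Here $S_{\lambda,\lambda'}$ is the family of the tableaux $T_a=(r_a,s_a)$, where $a$ runs over all maps from $\{k\ge1 : \sigma_k(\lambda')=\infty\}$ to $\overline{\mathbb{Z}}_8$, and $$r_a(k)=\rho_k(\lambda)-\rho_k(\lambda'),\qquad s_a(k)=\begin{cases}a(k)&\text{if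 }\sigma_k(\lambda')=\infty,\\ \sigma_k(\lambda)-\sigma_k(\lambda')&\text{if }\sigma_k(\lambda')\neq\infty.\end{cases}$$ -/

import Mathlib

/-- A linking pairing on a finite abelian group `G`: a symmetric biadditive map
`G × G → ℚ/ℤ` whose adjoint `G → Hom(G, ℚ/ℤ)` is bijective. -/
structure LinkingPairing (G : Type*) [AddCommGroup G] where
  /-- the adjoint homomorphism, so that the pairing is `(x, y) ↦ form x y` -/
  form : G →+ G →+ AddCircle (1 : ℚ)
  symm : ∀ x y, form x y = form y x
  bijective_adjoint : Function.Bijective form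

namespace LinkingPairing

/-- Isomorphism of linking pairings. -/
def Isomorphic {G H : Type*} [AddCommGroup G] [AddCommGroup H]
    (a : LinkingPairing G) (b : LinkingPairing H) : Prop :=
  ∃ e : G ≃+ H, ∀ x y, b.form (e x) (e y) = a.form x y

/-- The orthogonal sum:
`(a ⊕ b) ((x, x'), (y, y')) = a (x, y) + b (x', y')`. -/
def orthogonalSum {G H : Type*} [AddCommGroup G] [AddCommGroup H]
    (a : LinkingPairing G) (b : LinkingPairing H) : LinkingPairing (G × H) where
  form := AddMonoidHom.mk' (fun z => (a.form z.1).coprod (b.form z.2)) (by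
    intro z w
    ext x
    simp only [map_add, AddMonoidHom.coprod_apply, AddMonoidHom.add_apply, Prod.fst_add,
      Prod.snd_add]
    abel)
  symm x y := by simp [a.symm x.1 y.1, b.symm x.2 y.2]
  bijective_adjoint := by
    constructor
    · rw [injective_iff_map_eq_zero]
      intro z hz
      have h1 : a.form z.1 = 0 := by
        ext x
        simpa using DFunLike.congr_fun hz (x, 0)
      have h2 : b.form z.2 = 0 := by
        ext x
        simpa using DFunLike.congr_fun hz (0, x)
      exact Prod.ext ((injective_iff_map_eq_zero _).1 a.bijective_adjoint.1 _ h1)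
        ((injective_iff_map_eq_zero _).1 b.bijective_adjoint.1 _ h2)
    · intro f
      obtain ⟨x, hx⟩ := a.bijective_adjoint.2 (f.comp (AddMonoidHom.inl G H))
      obtain ⟨y, hy⟩ := b.bijective_adjoint.2 (f.comp (AddMonoidHom.inr G H))
      refine ⟨(x, y), ?_⟩
      ext z
      simp [hx, hy, -map_add]

@[simp]
theorem orthogonalSum_form {G H : Type*} [AddCommGroup G] [AddCommGroup H]
    (a : LinkingPairing G) (b : LinkingPairing H) (z w : G × H) :
    (a.orthogonalSum b).form z w = a.form z.1 w.1 + b.form z.2 w.2 := rfl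

/-- `b` is an orthogonal summand of `a`: there is a linking pairing `c` on a finite abelian
group with `a ≅ b ⊕ c`.  (A finite group has an isomorphic copy in `Type`, so that letting the
group of `c` range over `Type` is no restriction.) -/
def IsOrthogonalSummand {G H : Type*} [AddCommGroup G] [AddCommGroup H]
    (b : LinkingPairing H) (a : LinkingPairing G) : Prop :=
  ∃ (K : Type) (_ : AddCommGroup K) (_ : Fintype K) (c : LinkingPairing K),
    a.Isomorphic (b.orthogonalSum c)

end LinkingPairing

/-- The number of cyclic summands of order at least `2 ^ (j + 1)` in a finite abelian `2`-group:
the dimension over `𝔽₂` of `2 ^ j G / 2 ^ (j + 1) G`. -/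
noncomputable def twoLayerRank (G : Type*) [AddCommGroup G] (j : ℕ) : ℕ :=
  Nat.log 2 ((nsmulAddMonoidHom (α := G) (2 ^ (j + 1))).range.relIndex
    (nsmulAddMonoidHom (α := G) (2 ^ j)).range)

/-- The rank over `ℤ/2^k` of the free `ℤ/2^k`-module `G_k` in a decomposition `G = ⨁ G_k` of a
finite abelian `2`-group; see `homogeneousRank_eq_card`. -/
noncomputable def homogeneousRank (G : Type*) [AddCommGroup G] (k : ℕ+) : ℕ :=
  twoLayerRank G ((k : ℕ) - 1) - twoLayerRank G k

theorem card_range_nsmul_pi {G ι : Type*} [AddCommGroup G] [Fintype ι] (e : ι → ℕ)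
    (f : G ≃+ ((i : ι) → ZMod (2 ^ e i))) (j : ℕ) :
    Nat.card (nsmulAddMonoidHom (α := G) (2 ^ j)).range = 2 ^ ∑ i, (e i - j) := by
  have h1 : ∀ i, Nat.card (nsmulAddMonoidHom (α := ZMod (2 ^ e i)) (2 ^ j)).range
      = 2 ^ (e i - j) := by
    intro i
    have : (nsmulAddMonoidHom (α := ZMod (2 ^ e i)) (2 ^ j)).range
        = AddSubgroup.zmultiples (((2 ^ j : ℕ) : ZMod (2 ^ e i))) := by
      ext x
      simp only [AddMonoidHom.mem_range, AddSubgroup.mem_zmultiples_iff,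
        nsmulAddMonoidHom_apply]
      constructor
      · rintro ⟨y, rfl⟩
        obtain ⟨n, rfl⟩ := ZMod.intCast_surjective y
        exact ⟨n, by simp [mul_comm]⟩
      · rintro ⟨n, rfl⟩
        exact ⟨n, by simp [mul_comm]⟩
    rw [this, Nat.card_zmultiples, ZMod.addOrderOf_coe _ (by positivity)]
    rcases le_total (e i) j with h | h
    · rw [Nat.gcd_eq_left (pow_dvd_pow 2 h), Nat.div_self (by positivity),
        Nat.sub_eq_zero_of_le h, pow_zero]
    · rw [Nat.gcd_eq_right (pow_dvd_pow 2 h), Nat.pow_div h (by norm_num)]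
  rw [← Finset.prod_pow_eq_pow_sum, ← Finset.prod_congr rfl (fun i _ => h1 i), ← Nat.card_pi]
  refine Nat.card_congr ((f.toEquiv.subtypeEquiv
    (q := fun z => ∀ i, z i ∈ (nsmulAddMonoidHom (α := ZMod (2 ^ e i)) (2 ^ j)).range) ?_).trans
    (Equiv.subtypePiEquivPi (p := fun i z =>
      z ∈ (nsmulAddMonoidHom (α := ZMod (2 ^ e i)) (2 ^ j)).range)))
  intro x
  simp only [AddMonoidHom.mem_range, nsmulAddMonoidHom_apply]
  constructor
  · rintro ⟨y, rfl⟩ i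
    exact ⟨f y i, by simp⟩
  · intro h
    choose y hy using h
    refine ⟨f.symm y, f.injective ?_⟩
    ext i
    simpa using hy i

theorem twoLayerRank_eq_card {G ι : Type*} [AddCommGroup G] [Fintype ι] (e : ι → ℕ)
    (f : G ≃+ ((i : ι) → ZMod (2 ^ e i))) (j : ℕ) :
    twoLayerRank G j = (Finset.univ.filter fun i => j < e i).card := by
  have hle : (nsmulAddMonoidHom (α := G) (2 ^ (j + 1))).range ≤
      (nsmulAddMonoidHom (α := G) (2 ^ j)).range := by
    rintro _ ⟨y, rfl⟩
    exact ⟨2 • y, by simp [pow_succ, mul_smul]⟩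
  have h := AddSubgroup.relIndex_mul_relIndex ⊥ _ _ bot_le hle
  rw [AddSubgroup.relIndex_bot_left, AddSubgroup.relIndex_bot_left, mul_comm] at h
  rw [card_range_nsmul_pi e f, card_range_nsmul_pi e f] at h
  have hs : ∑ i, (e i - j) = (Finset.univ.filter fun i => j < e i).card +
      ∑ i, (e i - (j + 1)) := by
    rw [Finset.card_filter, ← Finset.sum_add_distrib]
    refine Finset.sum_congr rfl fun i _ => ?_
    split_ifs <;> omega
  rw [hs, pow_add 2 (Finset.card _)] at h
  have h' := Nat.eq_of_mul_eq_mul_right (Nat.two_pow_pos _) h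
  rw [twoLayerRank, h', Nat.log_pow (by norm_num)]

/-- In any decomposition of a `2`-group into cyclic groups, `homogeneousRank G k` is the number
of summands `ℤ/2^k`. -/
theorem homogeneousRank_eq_card {G ι : Type*} [AddCommGroup G] [Fintype ι] (e : ι → ℕ)
    (f : G ≃+ ((i : ι) → ZMod (2 ^ e i))) (k : ℕ+) :
    homogeneousRank G k = (Finset.univ.filter fun i => e i = k).card := by
  rw [homogeneousRank, twoLayerRank_eq_card e f, twoLayerRank_eq_card e f, Finset.card_filter,
    Finset.card_filter, Finset.card_filter, Nat.sub_eq_iff_eq_add, ← Finset.sum_add_distrib]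
  · have := k.pos
    refine Finset.sum_congr rfl fun i _ => ?_
    split_ifs <;> omega
  · refine Finset.sum_le_sum fun i _ => ?_
    split_ifs <;> omega

/-- For `k ≥ 1`, the map `ℚ/ℤ → ℂ`, `t ↦ exp (√-1 π 2^k t)`. -/
noncomputable def gaussTerm (k : ℕ+) : AddCircle (1 : ℚ) → ℂ :=
  Function.Periodic.lift
    (f := fun t : ℚ => Complex.exp (Complex.I * Real.pi * 2 ^ (k : ℕ) * t)) (by
      intro t
      obtain ⟨n, hn⟩ := Nat.exists_eq_add_of_lt k.pos
      have : Complex.I * Real.pi * 2 ^ (k : ℕ) * ((t + 1 : ℚ) : ℂ) =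
          Complex.I * Real.pi * 2 ^ (k : ℕ) * t +
            ((2 ^ n : ℕ) : ℂ) * (2 * Real.pi * Complex.I) := by
        rw [hn]
        push_cast
        ring
      simp only [this]
      rw [Complex.exp_add, Complex.exp_nat_mul_two_pi_mul_I, mul_one])

theorem gaussTerm_coe (k : ℕ+) (t : ℚ) :
    gaussTerm k (t : AddCircle (1 : ℚ)) =
      Complex.exp (Complex.I * Real.pi * 2 ^ (k : ℕ) * t) := rfl

/-- The monoid `ℤ/8 ∪ {∞}`, with `∞ + a = a + ∞ = ∞`; the element `∞` is `⊤`. -/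
abbrev ExtendedZMod8 := WithTop (ZMod 8)

open Classical in
/-- For a complex number `z` that is zero or has `z / |z|` an eighth root of unity: `∞` if
`z = 0`, and otherwise `Arg z / 2π` read in `(1/8)ℤ/ℤ = ℤ/8`, that is, the class `n` with
`z / |z| = exp (2 π √-1 n / 8)`; see `eighthPhase_eq`. -/
noncomputable def eighthPhase (z : ℂ) : ExtendedZMod8 :=
  if z = 0 then ⊤ else (((round (8 * (z.arg / (2 * Real.pi))) : ℤ) : ZMod 8) : ExtendedZMod8)

theorem eighthPhase_eq (r : ℝ) (hr : 0 < r) (n : ℤ) :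
    eighthPhase (r * Complex.exp (2 * Real.pi * Complex.I * (n / 8))) =
      ((n : ZMod 8) : ExtendedZMod8) := by
  have hne : (r : ℂ) * Complex.exp (2 * Real.pi * Complex.I * (n / 8)) ≠ 0 :=
    mul_ne_zero (by exact_mod_cast hr.ne') (Complex.exp_ne_zero _)
  rw [eighthPhase, if_neg hne, Complex.arg_real_mul _ hr]
  have h1 : (2 * Real.pi * Complex.I * (n / 8) : ℂ) =
      ((2 * Real.pi * (n / 8) : ℝ) : ℂ) * Complex.I := by
    push_cast
    ring
  rw [h1, Complex.arg_exp_mul_I, toIocMod]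
  set m := toIocDiv Real.two_pi_pos (-Real.pi) (2 * Real.pi * (n / 8))
  have h2 : 8 * ((2 * Real.pi * (n / 8) - m • (2 * Real.pi)) / (2 * Real.pi)) =
      ((n - 8 * m : ℤ) : ℝ) := by
    have := Real.pi_ne_zero
    push_cast
    rw [zsmul_eq_mul]
    field_simp
  rw [h2, round_intCast]
  have h3 : (8 : ZMod 8) = 0 := by decide
  rw [Int.cast_sub, Int.cast_mul]
  simp [h3]

namespace LinkingPairing

/-- The invariant `ρ_k`. -/
noncomputable def rho {G : Type*} [AddCommGroup G] (_a : LinkingPairing G) (k : ℕ+) : ℕ :=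
  homogeneousRank G k

/-- The Gauss sum `Γ_k = ∑ x, exp (√-1 π 2^k λ(x, x))`. -/
noncomputable def gaussSum {G : Type*} [AddCommGroup G] [Fintype G]
    (a : LinkingPairing G) (k : ℕ+) : ℂ :=
  ∑ x : G, gaussTerm k (a.form x x)

/-- The invariant `σ_k`, with values in `ℤ/8 ∪ {∞}`. -/
noncomputable def sigma {G : Type*} [AddCommGroup G] [Fintype G]
    (a : LinkingPairing G) (k : ℕ+) : ExtendedZMod8 :=
  eighthPhase (a.gaussSum k)

end LinkingPairing

/-- Tableaux `m ↦ (r m, s m)` on the positive integers. -/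
abbrev LinkingTableau := ℕ+ → ℕ × ExtendedZMod8

/-- A tableau is admissible if it is the tableau of the invariants `(ρ_m, σ_m)` of some linking
pairing on a finite abelian `2`-group. -/
def LinkingTableau.IsAdmissible (T : LinkingTableau) : Prop :=
  ∃ (K : Type) (_ : AddCommGroup K) (_ : Fintype K) (c : LinkingPairing K),
    IsPGroup 2 (Multiplicative K) ∧ ∀ m : ℕ+, T m = (c.rho m, c.sigma m)

/-- `u - v` in `ℤ/8 ∪ {∞}` for invertible `v`, that is, for `v` in `ℤ/8`. -/
def ExtendedZMod8.subFinite (u : ExtendedZMod8) (v : ZMod 8) : ExtendedZMod8 :=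
  u + ((-v : ZMod 8) : ExtendedZMod8)

/-- The tableau `T_c` of the pair `(a, b)`, for a map `c` from `{k | σ_k(b) = ∞}` to
`ℤ/8 ∪ {∞}`: its rank entries are `ρ_k(a) - ρ_k(b)`, its signature entries are `c k` where
`σ_k(b) = ∞` and `σ_k(a) - σ_k(b)` elsewhere.  It is meaningful when `ρ_k(b) ≤ ρ_k(a)` for
all `k`. -/
noncomputable def differenceTableau {G H : Type*} [AddCommGroup G] [Fintype G]
    [AddCommGroup H] [Fintype H] (a : LinkingPairing G) (b : LinkingPairing H)
    (c : {k : ℕ+ // b.sigma k = ⊤} → ExtendedZMod8) : LinkingTableau :=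
  open Classical in
  fun k => (a.rho k - b.rho k,
    if h : b.sigma k = ⊤ then c ⟨k, h⟩
    else ExtendedZMod8.subFinite (a.sigma k) ((b.sigma k).untop h))

/-- The family of all difference tableaux of the pair `(a, b)`. -/
def differenceTableaux {G H : Type*} [AddCommGroup G] [Fintype G]
    [AddCommGroup H] [Fintype H] (a : LinkingPairing G) (b : LinkingPairing H) :
    Set LinkingTableau :=
  Set.range (differenceTableau a b)

/-! Two facts suffice. The invariants are additive under orthogonal sum (`rho_orthogonalSum`,
`sigma_orthogonalSum`), and they classify linking pairings on finite abelian 2-groups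
(`isomorphic_of_rho_eq_of_sigma_eq`). A complement then realizes a difference tableau. Conversely, a
pairing realizing such a tableau is a complement: where `σ_k(b) = ∞`, the second condition makes
both sides `∞` whatever entry was chosen.

The classification avoids normal forms of pairings. List all elements of `G`; a tuple in `H` with
the same Gram matrix is a pairing-preserving map, hence an isomorphism when the orders agree. By
Fourier inversion, the number of tuples with a given Gram matrix is determined by the Gauss sums of
all integral quadratic forms evaluated through the pairing. It remains to show that these sums
depend only on the invariants.

Modulo the exponent `2 ^ N` an integral form splits into blocks `2 ^ r * u * x²` with `u` odd and `2
^ r * (a x² + b x y + c y²)` with `b` odd (`charSum_matForm_eq`). For unary blocks the Galois action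
removes `u`, leaving `Γ_{r+1}`: `σ` gives its vanishing and phase, and orders of torsion subgroups,
which `ρ` determines, give its modulus. Binary blocks reduce to `x y`, whose sum is a product of
group orders, or to `x² + x y + y²`, whose sum is plus or minus such a product. A symmetry of order
three fixes that sign modulo 3. -/

open scoped ComplexConjugate

/-! ### Characters of `ℚ/ℤ` and general Gauss sums. -/

/-- The character `t ↦ exp (2 π √-1 t)` of `ℚ/ℤ`. -/
noncomputable def circleChar : AddChar (AddCircle (1 : ℚ)) ℂ where
  toFun := gaussTerm 1
  map_zero_eq_one' := by
    have := gaussTerm_coe 1 0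
    simpa using this
  map_add_eq_mul' s t := by
    induction s using QuotientAddGroup.induction_on with | _ s => ?_
    induction t using QuotientAddGroup.induction_on with | _ t => ?_
    have h := gaussTerm_coe 1 (s + t)
    rw [AddCircle.coe_add] at h
    refine h.trans ?_
    rw [gaussTerm_coe, gaussTerm_coe, ← Complex.exp_add]
    congr 1
    push_cast
    ring

theorem circleChar_coe (t : ℚ) :
    circleChar (t : AddCircle (1 : ℚ)) = Complex.exp (2 * Real.pi * Complex.I * t) := by
  refine (gaussTerm_coe 1 t).trans ?_
  congr 1
  rw [PNat.one_coe]
  ring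

theorem gaussTerm_eq_circleChar (k : ℕ+) (t : AddCircle (1 : ℚ)) :
    gaussTerm k t = circleChar ((2 ^ ((k : ℕ) - 1) : ℤ) • t) := by
  induction t using QuotientAddGroup.induction_on with | _ t => ?_
  obtain ⟨n, hn⟩ := Nat.exists_eq_add_of_lt k.pos
  have h : (2 ^ ((k : ℕ) - 1) : ℤ) • (t : AddCircle (1 : ℚ)) =
      (((2 ^ ((k : ℕ) - 1) : ℤ) • t : ℚ) : AddCircle (1 : ℚ)) := rfl
  refine (gaussTerm_coe k t).trans ?_
  change _ = circleChar ((2 ^ ((k : ℕ) - 1) : ℤ) • (t : AddCircle (1 : ℚ)))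
  rw [h, circleChar_coe, hn]
  congr 1
  simp [pow_succ]
  ring

theorem circleChar_eq_one_iff (t : AddCircle (1 : ℚ)) : circleChar t = 1 ↔ t = 0 := by
  induction t using QuotientAddGroup.induction_on with | _ t => ?_
  change circleChar (t : AddCircle (1 : ℚ)) = 1 ↔ (t : AddCircle (1 : ℚ)) = 0
  rw [circleChar_coe, Complex.exp_eq_one_iff, AddCircle.coe_eq_zero_iff]
  refine exists_congr fun n => ?_
  have h : (2 * Real.pi * Complex.I : ℂ) ≠ 0 := Complex.two_pi_I_ne_zero
  rw [mul_comm, mul_left_inj' h]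
  constructor
  · intro h
    have : t = n := by exact_mod_cast h
    simp [this]
  · rintro rfl
    simp

theorem norm_circleChar (t : AddCircle (1 : ℚ)) : ‖circleChar t‖ = 1 := by
  induction t using QuotientAddGroup.induction_on with | _ t => ?_
  rw [circleChar_coe, show (2 * Real.pi * Complex.I * t : ℂ) = ((2 * Real.pi * t : ℝ) : ℂ) *
    Complex.I by push_cast; ring, Complex.norm_exp_ofReal_mul_I]

theorem conj_circleChar (t : AddCircle (1 : ℚ)) : conj (circleChar t) = circleChar (-t) := by
  rw [AddChar.map_neg_eq_inv, Complex.inv_eq_conj (norm_circleChar t)]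

theorem circleChar_sum {ι : Type*} (s : Finset ι) (t : ι → AddCircle (1 : ℚ)) :
    circleChar (∑ i ∈ s, t i) = ∏ i ∈ s, circleChar (t i) :=
  map_prod circleChar.toMonoidHom (fun i => Multiplicative.ofAdd (t i)) s

/-- The Gauss sum of a function with values in `ℚ/ℤ`. -/
noncomputable def charSum {X : Type*} [Fintype X] (q : X → AddCircle (1 : ℚ)) : ℂ :=
  ∑ x, circleChar (q x)

theorem conj_charSum {X : Type*} [Fintype X] (q : X → AddCircle (1 : ℚ)) :
    conj (charSum q) = charSum fun x => -q x := by
  simp [charSum, conj_circleChar]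

theorem charSum_equiv {X Y : Type*} [Fintype X] [Fintype Y] (e : X ≃ Y)
    (q : Y → AddCircle (1 : ℚ)) : charSum (fun x => q (e x)) = charSum q :=
  e.sum_comp fun y => circleChar (q y)

theorem charSum_congr_equiv {X Y : Type*} [Fintype X] [Fintype Y] (e : X ≃ Y)
    {p : X → AddCircle (1 : ℚ)} {q : Y → AddCircle (1 : ℚ)} (h : ∀ x, q (e x) = p x) :
    charSum p = charSum q := by
  rw [← charSum_equiv e]
  simp [h]

theorem charSum_prod {X Y : Type*} [Fintype X] [Fintype Y]
    (p : X → AddCircle (1 : ℚ)) (q : Y → AddCircle (1 : ℚ)) :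
    charSum (fun z : X × Y => p z.1 + q z.2) = charSum p * charSum q := by
  simp [charSum, Fintype.sum_prod_type, AddChar.map_add_eq_mul, Finset.sum_mul_sum]

theorem sum_range_circleChar {n : ℕ} (t : AddCircle (1 : ℚ)) (ht : n • t = 0) :
    ∑ j : Fin n, circleChar ((j : ℕ) • t) = if t = 0 then (n : ℂ) else 0 := by
  simp_rw [AddChar.map_nsmul_eq_pow]
  rw [Fin.sum_univ_eq_sum_range fun j => circleChar t ^ j]
  split_ifs with h
  · simp [h]
  · have h1 : circleChar t ≠ 1 := fun h' => h ((circleChar_eq_one_iff t).1 h')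
    rw [geom_sum_eq h1, ← AddChar.map_nsmul_eq_pow, ht]
    simp

theorem charSum_addMonoidHom {X : Type*} [AddCommGroup X] [Fintype X]
    (f : X →+ AddCircle (1 : ℚ)) [Decidable (f = 0)] :
    charSum f = if f = 0 then (Fintype.card X : ℂ) else 0 := by
  have h := AddChar.sum_eq_ite (circleChar.compAddMonoidHom f)
  have h0 : circleChar.compAddMonoidHom f = 0 ↔ f = 0 := by
    rw [DFunLike.ext_iff, DFunLike.ext_iff]
    exact forall_congr' fun x => circleChar_eq_one_iff (f x)
  refine (show charSum f = ∑ x, circleChar.compAddMonoidHom f x from rfl).trans ?_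
  rw [h]
  simp only [h0]

open Classical in
/-- The square of the absolute value of a quadratic Gauss sum. -/
theorem charSum_mul_conj {X : Type*} [AddCommGroup X] [Fintype X]
    (q : X → AddCircle (1 : ℚ)) (b : X →+ X →+ AddCircle (1 : ℚ))
    (h : ∀ z x, q (z + x) = q z + q x + b z x) :
    charSum q * conj (charSum q) =
      Fintype.card X * ∑ z, if b z = 0 then circleChar (q z) else 0 := by
  rw [conj_charSum, mul_comm]
  unfold charSum
  rw [Finset.sum_mul_sum]
  have h1 : ∀ x : X, ∑ y, circleChar (-q x) * circleChar (q y) =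
      ∑ z, circleChar (q z) * circleChar (b z x) := by
    intro x
    -- With `y = z + x` the terms `q x` cancel, leaving a character sum in `x` for each fixed `z`.
    rw [← Equiv.sum_comp (Equiv.addRight x)]
    refine Finset.sum_congr rfl fun z _ => ?_
    rw [← AddChar.map_add_eq_mul, ← AddChar.map_add_eq_mul, Equiv.coe_addRight, h]
    congr 1
    abel
  simp_rw [h1]
  rw [Finset.sum_comm, Finset.mul_sum]
  refine Finset.sum_congr rfl fun z _ => ?_
  rw [← Finset.mul_sum]
  have := charSum_addMonoidHom (b z)
  unfold charSum at this
  rw [this]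
  split_ifs <;> ring

theorem exists_pow_eq_circleChar {n : ℕ} [NeZero n] {ζ : ℂ} (hζ : IsPrimitiveRoot ζ n)
    (t : AddCircle (1 : ℚ)) (ht : n • t = 0) : ∃ m : ℕ, circleChar t = ζ ^ m := by
  have h : circleChar t ^ n = 1 := by
    rw [← AddChar.map_nsmul_eq_pow, ht, AddChar.map_zero_eq_one]
  obtain ⟨m, -, hm⟩ := hζ.eq_pow_of_pow_eq_one h
  exact ⟨m, hm.symm⟩

/-- Equality of two sums of roots of unity is preserved by the Galois action. -/
theorem charSum_nsmul_congr {X Y : Type*} [Fintype X] [Fintype Y] {n : ℕ} [NeZero n]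
    (p : X → AddCircle (1 : ℚ)) (q : Y → AddCircle (1 : ℚ))
    (hp : ∀ x, n • p x = 0) (hq : ∀ y, n • q y = 0) (h : charSum p = charSum q)
    {u : ℕ} (hu : u.Coprime n) :
    charSum (fun x => u • p x) = charSum fun y => u • q y := by
  have hζ := Complex.isPrimitiveRoot_exp n (NeZero.ne n)
  set ζ := Complex.exp (2 * Real.pi * Complex.I / n)
  choose f hf using fun x => exists_pow_eq_circleChar hζ (p x) (hp x)
  choose g hg using fun y => exists_pow_eq_circleChar hζ (q y) (hq y)
  -- `P` vanishes at `ζ`, hence is divisible by its minimal polynomial, which is also that of the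
  -- conjugate `ζ ^ u`.
  let P : Polynomial ℤ := ∑ x, Polynomial.X ^ f x - ∑ y, Polynomial.X ^ g y
  have hP : ∀ z : ℂ, Polynomial.aeval z P = ∑ x, z ^ f x - ∑ y, z ^ g y := by
    intro z
    simp [P]
  have h0 : Polynomial.aeval ζ P = 0 := by
    rw [hP, sub_eq_zero]
    simpa [charSum, hf, hg] using h
  have hd : minpoly ℤ ζ ∣ P :=
    minpoly.isIntegrallyClosed_dvd (hζ.isIntegral (NeZero.pos n)) h0
  have h1 : Polynomial.aeval (ζ ^ u) P = 0 := by
    obtain ⟨Q, hQ⟩ := hd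
    rw [hQ, hζ.minpoly_eq_pow_coprime hu, map_mul, minpoly.aeval, zero_mul]
  rw [hP, sub_eq_zero] at h1
  simpa [charSum, AddChar.map_nsmul_eq_pow, hf, hg, ← pow_mul, mul_comm] using h1

/-! ### Integral quadratic forms evaluated through a pairing. -/

/-- The quadratic form `x ↦ ∑ A i j • φ (x i) (x j)` on `ι → G`. -/
def matForm {G ι : Type*} [AddCommGroup G] [Fintype ι] (φ : G →+ G →+ AddCircle (1 : ℚ))
    (A : Matrix ι ι ℤ) (x : ι → G) : AddCircle (1 : ℚ) :=
  ∑ i, ∑ j, A i j • φ (x i) (x j)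

/-- Two integral matrices that define the same quadratic form modulo `n`. -/
def QuadCongr {ι : Type*} (n : ℤ) (A B : Matrix ι ι ℤ) : Prop :=
  (∀ i, n ∣ A i i - B i i) ∧ ∀ i j, i ≠ j → n ∣ (A i j + A j i) - (B i j + B j i)

section matForm

variable {G ι κ : Type*} [AddCommGroup G] [Fintype ι] [Fintype κ]
  {φ : G →+ G →+ AddCircle (1 : ℚ)}

theorem zsmul_form_eq_of_dvd {n : ℤ} (hn : ∀ x : G, n • x = 0) {a b : ℤ} (h : n ∣ a - b)
    (x y : G) : a • φ x y = b • φ x y := by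
  obtain ⟨c, hc⟩ := h
  have h0 : n • φ x y = 0 := by rw [← AddMonoidHom.smul_apply, ← map_zsmul φ, hn]; simp
  rw [show a = b + c * n by linarith, add_smul, mul_smul, h0]
  simp

/-- By symmetry of `φ` only the sums `A i j + A j i` matter off the diagonal, so the differences
cancel in pairs under `(i, j) ↦ (j, i)`. -/
theorem matForm_congr (hφ : ∀ x y, φ x y = φ y x) {n : ℤ} (hn : ∀ x : G, n • x = 0)
    {A B : Matrix ι ι ℤ} (h : QuadCongr n A B) : matForm φ A = matForm φ B := by
  classical
  funext x
  rw [← sub_eq_zero]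
  unfold matForm
  rw [← Fintype.sum_prod_type' (f := fun i j => A i j • φ (x i) (x j)),
    ← Fintype.sum_prod_type' (f := fun i j => B i j • φ (x i) (x j)), ← Finset.sum_sub_distrib]
  have hd : ∀ i, A i i • φ (x i) (x i) = B i i • φ (x i) (x i) := fun i =>
    zsmul_form_eq_of_dvd hn (h.1 i) _ _
  refine Finset.sum_involution (fun z _ => z.swap) ?_ ?_ (fun _ _ => Finset.mem_univ _)
    (fun _ _ => Prod.swap_swap _)
  · rintro ⟨i, j⟩ -
    simp only [Prod.fst_swap, Prod.snd_swap]
    by_cases hij : i = j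
    · subst hij
      simp [hd]
    · rw [hφ (x j) (x i), ← sub_smul, ← sub_smul, ← add_smul]
      rw [zsmul_form_eq_of_dvd hn (b := 0), zero_smul]
      have := h.2 i j hij
      convert this using 1
      ring
  · rintro ⟨i, j⟩ - hne heq
    apply hne
    have : j = i := congrArg Prod.fst heq
    subst this
    simp [hd]

theorem matForm_mulVec [DecidableEq ι] (A : Matrix ι ι ℤ) (P : Matrix ι κ ℤ) (y : κ → G) :
    matForm φ A (fun i => ∑ k, P i k • y k) = matForm φ (P.transpose * A * P) y := by
  have hl : matForm φ A (fun i => ∑ k, P i k • y k) =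
      ∑ i, ∑ j, ∑ k, ∑ l, (P i k * A i j * P j l) • φ (y k) (y l) := by
    unfold matForm
    refine Finset.sum_congr rfl fun i _ => Finset.sum_congr rfl fun j _ => ?_
    simp only [map_sum, map_zsmul, AddMonoidHom.finsetSum_apply, AddMonoidHom.smul_apply,
      Finset.smul_sum, smul_smul]
    rw [Finset.sum_comm]
    refine Finset.sum_congr rfl fun k _ => Finset.sum_congr rfl fun l _ => ?_
    congr 1
    ring
  have hr : matForm φ (P.transpose * A * P) y =
      ∑ k, ∑ l, ∑ j, ∑ i, (P i k * A i j * P j l) • φ (y k) (y l) := by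
    unfold matForm
    simp only [Matrix.mul_apply, Matrix.transpose_apply, Finset.sum_mul, Finset.sum_smul]
  rw [hl, hr]
  calc _ = ∑ i, ∑ k, ∑ j, ∑ l, (P i k * A i j * P j l) • φ (y k) (y l) :=
        Finset.sum_congr rfl fun _ _ => Finset.sum_comm
    _ = ∑ k, ∑ i, ∑ l, ∑ j, (P i k * A i j * P j l) • φ (y k) (y l) := by
        rw [Finset.sum_comm]
        exact Finset.sum_congr rfl fun _ _ => Finset.sum_congr rfl fun _ _ => Finset.sum_comm
    _ = _ := Finset.sum_congr rfl fun _ _ => by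
        rw [Finset.sum_comm]
        exact Finset.sum_congr rfl fun _ _ => Finset.sum_comm

/-- The substitution `x = P y` is injective because `adj P * P = det P` and `det P` acts injectively
on `G`; finiteness makes it bijective. -/
theorem charSum_matForm_conj [Fintype G] [DecidableEq ι] (A P : Matrix ι ι ℤ)
    (hP : ∀ x : G, P.det • x = 0 → x = 0) :
    charSum (matForm φ (P.transpose * A * P)) = charSum (matForm φ A) := by
  let f : (ι → G) →+ (ι → G) := AddMonoidHom.mk' (fun y i => ∑ k, P i k • y k) (by
    intro y z
    ext i
    simp [smul_add, Finset.sum_add_distrib])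
  have hf : Function.Injective f := by
    rw [injective_iff_map_eq_zero]
    intro y hy
    ext l
    apply hP
    have h1 : ∑ i, P.adjugate l i • f y i = 0 := by simp [hy]
    rw [← h1]
    simp only [f, AddMonoidHom.mk'_apply, Finset.smul_sum, smul_smul]
    rw [Finset.sum_comm]
    simp_rw [← Finset.sum_smul, ← Matrix.mul_apply, Matrix.adjugate_mul, Matrix.smul_apply,
      Matrix.one_apply]
    simp
  refine charSum_congr_equiv (Equiv.ofBijective f (Finite.injective_iff_bijective.1 hf))
    fun y => ?_
  exact matForm_mulVec A P y

theorem charSum_matForm_submatrix [Fintype G] [DecidableEq ι] [DecidableEq κ] (A : Matrix ι ι ℤ)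
    (e : κ ≃ ι) : charSum (matForm φ (A.submatrix e e)) = charSum (matForm φ A) := by
  refine (charSum_congr_equiv (e.arrowCongr (Equiv.refl G)).symm fun x => ?_).symm
  unfold matForm
  rw [← e.sum_comp]
  refine Finset.sum_congr rfl fun i _ => ?_
  rw [← e.sum_comp]
  rfl

theorem charSum_matForm_fromBlocks_diagonal [Fintype G] [DecidableEq ι] [DecidableEq κ]
    (A : Matrix ι ι ℤ) (D : Matrix κ κ ℤ) :
    charSum (matForm φ (Matrix.fromBlocks A 0 0 D)) =
      charSum (matForm φ A) * charSum (matForm φ D) := by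
  rw [← charSum_prod]
  refine charSum_congr_equiv (Equiv.sumArrowEquivProdArrow ι κ G) fun x => ?_
  simp [matForm, Fintype.sum_sum_type]

/-- Splitting off a block by completing the square modulo `n`. -/
theorem charSum_matForm_fromBlocks [Fintype G] [DecidableEq ι] [DecidableEq κ]
    (hφ : ∀ x y, φ x y = φ y x) {n : ℤ} (hn : ∀ x : G, n • x = 0)
    (A : Matrix ι ι ℤ) (B : Matrix ι κ ℤ) (C : Matrix κ ι ℤ) (D : Matrix κ κ ℤ)
    (L : Matrix ι κ ℤ)
    (h : ∀ i j, n ∣ ((A + A.transpose) * L + B + C.transpose) i j) :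
    charSum (matForm φ (Matrix.fromBlocks A B C D)) = charSum (matForm φ A) *
      charSum (matForm φ (L.transpose * A * L + C * L + L.transpose * B + D)) := by
  have hdet : (Matrix.fromBlocks 1 L 0 1 : Matrix (ι ⊕ κ) (ι ⊕ κ) ℤ).det = 1 := by simp
  rw [← charSum_matForm_conj _ (Matrix.fromBlocks 1 L 0 1) (by simp [hdet]),
    ← charSum_matForm_fromBlocks_diagonal]
  congr 1
  refine matForm_congr hφ hn ?_
  rw [Matrix.fromBlocks_transpose, Matrix.fromBlocks_multiply, Matrix.fromBlocks_multiply]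
  simp only [Matrix.transpose_one, Matrix.transpose_zero, Matrix.one_mul, Matrix.mul_one,
    Matrix.zero_mul, Matrix.mul_zero, add_zero]
  constructor
  · rintro (i | i)
    · simp
    · simp only [Matrix.fromBlocks_apply₂₂, Matrix.add_mul]
      simp [Matrix.add_apply]
      ring_nf
      simp
  · have key : ∀ i j, n ∣ (A * L + B) i j + (L.transpose * A + C) j i := by
      intro i j
      convert h i j using 1
      simp only [Matrix.add_mul, Matrix.add_apply, Matrix.transpose_apply]
      have : (A.transpose * L) i j = (L.transpose * A) j i := by
        rw [← Matrix.transpose_apply (L.transpose * A), Matrix.transpose_mul,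
          Matrix.transpose_transpose]
      rw [this]
      ring
    rintro (i | i) (j | j) hij
    · simp
    · simpa using key i j
    · simpa [add_comm] using key j i
    · simp only [Matrix.fromBlocks_apply₂₂, Matrix.add_mul]
      simp [Matrix.add_apply]
      ring_nf
      simp

end matForm

/-! ### Splitting integral forms into unary and binary blocks modulo `2 ^ N`. -/

/-- All coefficients of the quadratic form of `A` are divisible by `d`. -/
def CoeffDvd {ι : Type*} (d : ℤ) (A : Matrix ι ι ℤ) : Prop :=
  (∀ i, d ∣ A i i) ∧ ∀ i j, i ≠ j → d ∣ A i j + A j i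

theorem CoeffDvd.submatrix {ι κ : Type*} {d : ℤ} {A : Matrix ι ι ℤ} (h : CoeffDvd d A)
    (e : κ ≃ ι) : CoeffDvd d (A.submatrix e e) :=
  ⟨fun i => h.1 (e i), fun _ _ hij => h.2 _ _ (e.injective.ne hij)⟩

theorem exists_equiv_fin_sum {ι : Type} [Fintype ι] [DecidableEq ι] {m : ℕ} (f : Fin m → ι)
    (hf : Function.Injective f) : ∃ (κ : Type) (_ : Fintype κ) (_ : DecidableEq κ)
      (e : Fin m ⊕ κ ≃ ι), (∀ i, e (Sum.inl i) = f i) ∧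
        Fintype.card ι = m + Fintype.card κ := by
  classical
  let e : Fin m ⊕ ((Set.range f)ᶜ : Set ι) ≃ ι :=
    ((Equiv.ofInjective f hf).sumCongr (Equiv.refl _)).trans (Equiv.Set.sumCompl (Set.range f))
  refine ⟨((Set.range f)ᶜ : Set ι), inferInstance, inferInstance, e, fun i => ?_, ?_⟩
  · simp [e]
  · rw [← Fintype.card_congr e, Fintype.card_sum, Fintype.card_fin]

theorem exists_mul_eq_one_add_two_pow {u : ℤ} (hu : Odd u) (N : ℕ) :
    ∃ w z : ℤ, u * w = 1 + 2 ^ N * z := by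
  have h : IsCoprime u (2 ^ N) := (Int.isCoprime_iff_gcd_eq_one.2 (by
    rcases hu with ⟨k, rfl⟩
    rw [← Int.isCoprime_iff_gcd_eq_one]
    exact ⟨1, -k, by ring⟩)).pow_right
  obtain ⟨w, z, h⟩ := h
  exact ⟨w, -z, by linarith⟩

/-- The sum of a binary quadratic form `a x² + b x y + c y²` scaled by `2 ^ r`. -/
def binaryForm {G : Type*} [AddCommGroup G] (φ : G →+ G →+ AddCircle (1 : ℚ))
    (a b c : ℤ) (z : G × G) : AddCircle (1 : ℚ) :=
  a • φ z.1 z.1 + b • φ z.1 z.2 + c • φ z.2 z.2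

section

variable {G : Type*} [AddCommGroup G] {φ : G →+ G →+ AddCircle (1 : ℚ)}

theorem charSum_matForm_fin_one [Fintype G] (A : Matrix (Fin 1) (Fin 1) ℤ) :
    charSum (matForm φ A) = charSum fun x => A 0 0 • φ x x := by
  refine charSum_congr_equiv (Equiv.funUnique (Fin 1) G) fun x => ?_
  simp [matForm]

theorem matForm_fin_two (hφ : ∀ x y, φ x y = φ y x) (A : Matrix (Fin 2) (Fin 2) ℤ)
    (x : Fin 2 → G) :
    matForm φ A x = binaryForm φ (A 0 0) (A 0 1 + A 1 0) (A 1 1) (x 0, x 1) := by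
  simp only [matForm, binaryForm, Fin.sum_univ_two, hφ (x 1) (x 0), add_smul]
  abel

theorem charSum_matForm_fin_two [Fintype G] (hφ : ∀ x y, φ x y = φ y x) (A : Matrix (Fin 2) (Fin 2) ℤ) :
    charSum (matForm φ A) = charSum (binaryForm φ (A 0 0) (A 0 1 + A 1 0) (A 1 1)) :=
  charSum_congr_equiv (finTwoArrowEquiv G) fun x => (matForm_fin_two hφ A x).symm

end

section

variable {G H : Type*} [AddCommGroup G] [AddCommGroup H] [Fintype G] [Fintype H]
  {φ : G →+ G →+ AddCircle (1 : ℚ)} {ψ : H →+ H →+ AddCircle (1 : ℚ)}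

/-- If the Gauss sums of `φ` and `ψ` with values in unary forms and in binary even forms agree,
then those with values in all integral quadratic forms agree. -/
theorem charSum_matForm_eq (hφ : ∀ x y, φ x y = φ y x) (hψ : ∀ x y, ψ x y = ψ y x) {N : ℕ}
    (hG : ∀ x : G, (2 ^ N : ℤ) • x = 0) (hH : ∀ x : H, (2 ^ N : ℤ) • x = 0)
    (hcard : Fintype.card G = Fintype.card H)
    (h1 : ∀ (r : ℕ) (u : ℤ), Odd u →
      charSum (fun x => (2 ^ r * u) • φ x x) = charSum fun x => (2 ^ r * u) • ψ x x)
    (h2 : ∀ (r : ℕ) (a b c : ℤ), Odd b →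
      charSum (binaryForm φ (2 ^ r * a) (2 ^ r * b) (2 ^ r * c)) =
        charSum (binaryForm ψ (2 ^ r * a) (2 ^ r * b) (2 ^ r * c)))
    (ι : Type) [Fintype ι] [DecidableEq ι] (A : Matrix ι ι ℤ) :
    charSum (matForm φ A) = charSum (matForm ψ A) := by
  induction hm : Fintype.card ι using Nat.strong_induction_on generalizing ι with
  | _ m IH => ?_
  subst hm
  -- Inner induction on `N - r`, where `2 ^ r` divides all coefficients. Once `r = N` the form
  -- vanishes; otherwise either `r` increases or a block of exact scale `2 ^ r` splits off and the
  -- number of variables drops.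
  have main : ∀ d r : ℕ, r + d = N → CoeffDvd (2 ^ r) A →
      charSum (matForm φ A) = charSum (matForm ψ A) := by
    intro d
    induction d with
    | zero =>
      intro r hr hA
      obtain rfl : r = N := by omega
      have h0 : QuadCongr (2 ^ r) A 0 := by simpa [QuadCongr, CoeffDvd] using hA
      rw [matForm_congr hφ hG h0, matForm_congr hψ hH h0]
      simp [charSum, matForm, hcard]
    | succ d ihd =>
      intro r hr hA
      by_cases hA' : CoeffDvd (2 ^ (r + 1)) A
      · exact ihd (r + 1) (by omega) hA'
      have hodd : ∀ z : ℤ, ¬ (2 ^ (r + 1) : ℤ) ∣ 2 ^ r * z → Odd z := by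
        intro z hz
        by_contra hz'
        rw [Int.not_odd_iff_even, even_iff_two_dvd] at hz'
        exact hz (by rw [pow_succ]; exact mul_dvd_mul_left _ hz')
      by_cases hoff : ∃ i j, i ≠ j ∧ ¬ (2 ^ (r + 1) : ℤ) ∣ A i j + A j i
      · obtain ⟨i, j, hij, hd⟩ := hoff
        obtain ⟨κ, _, _, e, he, hc⟩ := exists_equiv_fin_sum ![i, j] (by
          intro x y hxy
          fin_cases x <;> fin_cases y <;> simp_all [eq_comm])
        have hB := hA.submatrix e
        rw [← charSum_matForm_submatrix A e, ← charSum_matForm_submatrix A e]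
        have hd' : ¬ (2 ^ (r + 1) : ℤ) ∣ A.submatrix e e (Sum.inl 0) (Sum.inl 1) +
            A.submatrix e e (Sum.inl 1) (Sum.inl 0) := by simpa [he] using hd
        generalize A.submatrix e e = B at hB hd'
        obtain ⟨a, ha⟩ := hB.1 (Sum.inl 0)
        obtain ⟨b, hb⟩ := hB.2 (Sum.inl 0) (Sum.inl 1) (by simp)
        obtain ⟨c, hc'⟩ := hB.1 (Sum.inl 1)
        rw [hb] at hd'
        have hbo := hodd b hd'
        choose M hM using fun (i : Fin 2) (j : κ) => hB.2 (Sum.inl i) (Sum.inr j) (by simp)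
        -- The polar matrix of the block is `2 ^ r` times `[[2a, b], [b, 2c]]`, of odd determinant.
        -- With `w` its inverse modulo `2 ^ N`, `L` is `-w` times the adjugate applied to `M`.
        obtain ⟨w, z, hw⟩ := exists_mul_eq_one_add_two_pow (u := 4 * a * c - b ^ 2)
          (by rw [mul_assoc]; exact (Int.even_mul.2 (Or.inl (by decide))).sub_odd hbo.pow) N
        let L : Matrix (Fin 2) κ ℤ := Matrix.of
          ![fun j => -w * (2 * c * M 0 j - b * M 1 j), fun j => -w * (2 * a * M 1 j - b * M 0 j)]
        have hL : ∀ i j, (2 ^ N : ℤ) ∣ ((B.toBlocks₁₁ + B.toBlocks₁₁.transpose) * L +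
            B.toBlocks₁₂ + B.toBlocks₂₁.transpose) i j := by
          intro i j
          have hb' : B (Sum.inl 1) (Sum.inl 0) = 2 ^ r * b - B (Sum.inl 0) (Sum.inl 1) := by
            linarith
          have hMj : ∀ i, B (Sum.inr j) (Sum.inl i) =
            2 ^ r * M i j - B (Sum.inl i) (Sum.inr j) := fun i => by linarith [hM i j]
          refine ⟨-2 ^ r * z * M i j, ?_⟩
          have hw' : (2 ^ N : ℤ) * z = (4 * a * c - b ^ 2) * w - 1 := by linarith
          fin_cases i <;>
          simp [Matrix.mul_apply, Fin.sum_univ_two, Matrix.add_apply, Matrix.toBlocks₁₁,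
            Matrix.toBlocks₁₂, Matrix.toBlocks₂₁, L, ha, hc', hb', hMj]
          · linear_combination (2 ^ r * M 0 j) * hw'
          · linear_combination (2 ^ r * M 1 j) * hw'
        rw [← Matrix.fromBlocks_toBlocks B, charSum_matForm_fromBlocks hφ hG _ _ _ _ L hL,
          charSum_matForm_fromBlocks hψ hH _ _ _ _ L hL,
          IH (Fintype.card κ) (by omega) κ _ rfl, charSum_matForm_fin_two hφ,
          charSum_matForm_fin_two hψ]
        congr 1
        simp only [Matrix.toBlocks₁₁, Matrix.of_apply]
        rw [ha, hb, hc']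
        exact h2 r a b c hbo
      · push Not at hoff
        have hdiag : ∃ i, ¬ (2 ^ (r + 1) : ℤ) ∣ A i i := by
          by_contra! h
          exact hA' ⟨h, hoff⟩
        obtain ⟨i, hd⟩ := hdiag
        obtain ⟨κ, _, _, e, he, hc⟩ := exists_equiv_fin_sum ![i]
          (Function.injective_of_subsingleton _)
        have hB := hA.submatrix e
        have hB' : ∀ x y, x ≠ y → (2 ^ (r + 1) : ℤ) ∣ A.submatrix e e x y +
          A.submatrix e e y x := fun x y hxy => hoff _ _ (e.injective.ne hxy)
        rw [← charSum_matForm_submatrix A e, ← charSum_matForm_submatrix A e]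
        have hd' : ¬ (2 ^ (r + 1) : ℤ) ∣ A.submatrix e e (Sum.inl 0) (Sum.inl 0) := by
          simpa [he] using hd
        generalize A.submatrix e e = B at hB hB' hd'
        obtain ⟨u, hu⟩ := hB.1 (Sum.inl 0)
        rw [hu] at hd'
        have huo := hodd u hd'
        -- No cross coefficient has exact scale `2 ^ r`, so all carry the extra factor 2 that
        -- completing the square of `2 ^ r * u * x²` requires.
        choose M hM using fun (i : Fin 1) (j : κ) => hB' (Sum.inl i) (Sum.inr j) (by simp)
        obtain ⟨w, z, hw⟩ := exists_mul_eq_one_add_two_pow huo N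
        let L : Matrix (Fin 1) κ ℤ := Matrix.of fun i j => -w * M i j
        have hL : ∀ i j, (2 ^ N : ℤ) ∣ ((B.toBlocks₁₁ + B.toBlocks₁₁.transpose) * L +
            B.toBlocks₁₂ + B.toBlocks₂₁.transpose) i j := by
          intro i j
          have hMj : ∀ i, B (Sum.inr j) (Sum.inl i) =
            2 ^ (r + 1) * M i j - B (Sum.inl i) (Sum.inr j) := fun i => by linarith [hM i j]
          refine ⟨-2 ^ (r + 1) * z * M i j, ?_⟩
          have hw' : (2 ^ N : ℤ) * z = u * w - 1 := by linarith
          fin_cases i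
          simp [Matrix.mul_apply, Matrix.add_apply, Matrix.toBlocks₁₁,
            Matrix.toBlocks₁₂, Matrix.toBlocks₂₁, L, hu, hMj]
          linear_combination (2 ^ (r + 1) * M 0 j) * hw'
        rw [← Matrix.fromBlocks_toBlocks B, charSum_matForm_fromBlocks hφ hG _ _ _ _ L hL,
          charSum_matForm_fromBlocks hψ hH _ _ _ _ L hL,
          IH (Fintype.card κ) (by omega) κ _ rfl, charSum_matForm_fin_one,
          charSum_matForm_fin_one]
        congr 1
        simp only [Matrix.toBlocks₁₁, Matrix.of_apply]
        rw [hu]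
        exact h1 r u huo
  exact main N 0 (by omega) ⟨fun i => by simp, fun i j _ => by simp⟩

end

/-! ### Recovering a pairing from its Gauss sums. -/

/-- Fourier inversion for the number of solutions of a system of equations in `ℚ/ℤ`. -/
theorem sum_circleChar_mul_charSum {X P : Type*} [Fintype X] [Fintype P] [DecidableEq P] {n : ℕ}
    (t : X → P → AddCircle (1 : ℚ)) (c : P → AddCircle (1 : ℚ))
    (h : ∀ x p, n • (t x p - c p) = 0) :
    ∑ A : P → Fin n, circleChar (-∑ p, (A p : ℕ) • c p) *
        charSum (fun x => ∑ p, (A p : ℕ) • t x p) =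
      Nat.card {x // t x = c} * (n : ℂ) ^ Fintype.card P := by
  classical
  have h1 : ∀ A : P → Fin n, circleChar (-∑ p, (A p : ℕ) • c p) *
      charSum (fun x => ∑ p, (A p : ℕ) • t x p) =
      ∑ x, ∏ p, circleChar ((A p : ℕ) • (t x p - c p)) := by
    intro A
    unfold charSum
    rw [Finset.mul_sum]
    refine Finset.sum_congr rfl fun x _ => ?_
    rw [← AddChar.map_add_eq_mul, ← circleChar_sum]
    congr 1
    simp only [smul_sub, Finset.sum_sub_distrib]
    abel
  simp_rw [h1]
  rw [Finset.sum_comm]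
  have h2 : ∀ x, ∑ A : P → Fin n, ∏ p, circleChar ((A p : ℕ) • (t x p - c p)) =
      if t x = c then (n : ℂ) ^ Fintype.card P else 0 := by
    intro x
    have := Finset.prod_univ_sum (fun _ : P => (Finset.univ : Finset (Fin n)))
      (fun p j => circleChar ((j : ℕ) • (t x p - c p)))
    rw [Fintype.piFinset_univ] at this
    rw [← this]
    simp_rw [sum_range_circleChar _ (h x _), sub_eq_zero]
    split_ifs with hx
    · simp [hx]
    · obtain ⟨p, hp⟩ := Function.ne_iff.1 hx
      exact Finset.prod_eq_zero (Finset.mem_univ p) (if_neg hp)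
  simp_rw [h2]
  rw [← Finset.sum_filter, Finset.sum_const, Nat.card_eq_fintype_card, Fintype.card_subtype,
    nsmul_eq_mul]

/-- By Fourier inversion `t` and `s` have fibres of equal size over `t x`, and the fibre of `t`
contains `x`. -/
theorem exists_eq_of_charSum_eq {X Y P : Type*} [Fintype X] [Fintype Y] [Fintype P]
    [DecidableEq P] {n : ℕ} (hn : n ≠ 0) (t : X → P → AddCircle (1 : ℚ))
    (s : Y → P → AddCircle (1 : ℚ)) (ht : ∀ x p, n • t x p = 0) (hs : ∀ y p, n • s y p = 0)
    (h : ∀ A : P → ℕ, charSum (fun x => ∑ p, A p • t x p) = charSum fun y => ∑ p, A p • s y p)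
    (x : X) : ∃ y, s y = t x := by
  have h1 := sum_circleChar_mul_charSum t (t x) (n := n) (by simp [smul_sub, ht])
  have h2 := sum_circleChar_mul_charSum s (t x) (n := n) (by simp [smul_sub, ht, hs])
  simp_rw [h] at h1
  rw [h2] at h1
  have h3 : (Nat.card {y // s y = t x} : ℂ) = Nat.card {x' // t x' = t x} :=
    mul_right_cancel₀ (pow_ne_zero _ (Nat.cast_ne_zero.2 hn)) h1
  have h4 : 0 < Nat.card {x' // t x' = t x} := Nat.card_pos_iff.2 ⟨⟨⟨x, rfl⟩⟩, inferInstance⟩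
  rw [← Nat.cast_inj.1 h3] at h4
  obtain ⟨⟨y, hy⟩⟩ := (Nat.card_pos_iff.1 h4).1
  exact ⟨y, hy⟩

/-- A map that preserves nondegenerate pairings on groups of the same order is an isomorphism. -/
theorem exists_addEquiv_of_form_eq {G H : Type*} [AddCommGroup G] [AddCommGroup H] [Fintype G]
    [Fintype H] {φ : G →+ G →+ AddCircle (1 : ℚ)} {ψ : H →+ H →+ AddCircle (1 : ℚ)}
    (hφ : Function.Injective φ) (hψ : Function.Injective ψ)
    (hcard : Fintype.card G = Fintype.card H) (f : G → H)
    (hf : ∀ x y, ψ (f x) (f y) = φ x y) : ∃ e : G ≃+ H, ∀ x y, ψ (e x) (e y) = φ x y := by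
  have hinj : Function.Injective f := by
    intro x y hxy
    apply hφ
    ext z
    rw [← hf, ← hf, hxy]
  have hbij : Function.Bijective f := (Fintype.bijective_iff_injective_and_card f).2 ⟨hinj, hcard⟩
  -- By surjectivity of `f` it suffices to pair both sides with elements `f z`.
  have hadd : ∀ x y, f (x + y) = f x + f y := by
    intro x y
    apply hψ
    ext w
    obtain ⟨z, rfl⟩ := hbij.2 w
    simp [hf]
  exact ⟨AddEquiv.mk' (Equiv.ofBijective f hbij) hadd, hf⟩

theorem card_nsmul_form {K : Type*} [AddCommGroup K] [Fintype K] {n : ℕ}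
    (hn : Fintype.card K = n) (χ : K →+ K →+ AddCircle (1 : ℚ)) (x y : K) : n • χ x y = 0 := by
  rw [← hn, ← map_nsmul, card_nsmul_eq_zero, map_zero]

/-- The Gram matrix of the tuple listing all of `G` is the whole pairing; a tuple in `H` with that
Gram matrix is the required map. -/
theorem exists_addEquiv_of_charSum_eq {G H : Type*} [AddCommGroup G] [AddCommGroup H] [Fintype G]
    [Fintype H] {φ : G →+ G →+ AddCircle (1 : ℚ)} {ψ : H →+ H →+ AddCircle (1 : ℚ)}
    (hφ : Function.Injective φ) (hψ : Function.Injective ψ)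
    (hcard : Fintype.card G = Fintype.card H)
    (h : ∀ (n : ℕ) (A : Matrix (Fin n) (Fin n) ℤ),
      charSum (matForm φ A) = charSum (matForm ψ A)) :
    ∃ e : G ≃+ H, ∀ x y, ψ (e x) (e y) = φ x y := by
  let g := (Fintype.equivFin G).symm
  obtain ⟨y, hy⟩ := exists_eq_of_charSum_eq (P := Fin (Fintype.card G) × Fin (Fintype.card G))
    (n := Fintype.card G) Fintype.card_ne_zero
    (fun (x : Fin (Fintype.card G) → G) p => φ (x p.1) (x p.2))
    (fun (y : Fin (Fintype.card G) → H) p => ψ (y p.1) (y p.2))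
    (fun x p => card_nsmul_form rfl φ _ _) (fun y p => card_nsmul_form hcard.symm ψ _ _) (fun A => by
      have := h _ (Matrix.of fun i j => (A (i, j) : ℤ))
      unfold matForm at this
      simpa [Fintype.sum_prod_type] using this) g
  refine exists_addEquiv_of_form_eq hφ hψ hcard (fun x => y (g.symm x)) fun x x' => ?_
  simpa using congrFun hy (g.symm x, g.symm x')

/-! ### Modulus and phase of unary Gauss sums. -/

/-- On the radical `b.ker` the function `q` is additive, so its sum there is the order of the
radical or zero; zero would make the whole sum vanish. -/
theorem charSum_mul_conj_of_ne_zero {X : Type*} [AddCommGroup X] [Fintype X]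
    (q : X → AddCircle (1 : ℚ)) (b : X →+ X →+ AddCircle (1 : ℚ))
    (h : ∀ z x, q (z + x) = q z + q x + b z x) (hne : charSum q ≠ 0) :
    charSum q * conj (charSum q) = Fintype.card X * Nat.card b.ker := by
  classical
  have h1 := charSum_mul_conj q b h
  have hq : ∑ z, (if b z = 0 then circleChar (q z) else 0) =
      charSum fun z : b.ker => q z := by
    unfold charSum
    rw [← Finset.sum_filter]
    exact (Finset.sum_subtype _ (p := fun z => z ∈ b.ker) (by simp [AddMonoidHom.mem_ker])
      fun z => circleChar (q z))
  let f : b.ker →+ AddCircle (1 : ℚ) := AddMonoidHom.mk' (fun z => q z) (by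
    intro z x
    have := h z x
    rw [AddMonoidHom.mem_ker.1 z.2] at this
    simpa using this)
  rw [h1, hq]
  congr 1
  refine (charSum_addMonoidHom f).trans ?_
  split_ifs with hf
  · rw [Nat.card_eq_fintype_card]
  · exfalso
    have h2 : charSum (fun z : b.ker => q z) = 0 := (charSum_addMonoidHom f).trans (if_neg hf)
    rw [hq, h2, mul_zero] at h1
    exact hne (by simpa using h1)

section

variable {G : Type*} [AddCommGroup G] {φ : G →+ G →+ AddCircle (1 : ℚ)}

theorem eq_zero_of_odd_zsmul {N : ℕ} {x : G} (hN : (2 ^ N : ℤ) • x = 0) {d : ℤ} (hd : Odd d)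
    (hx : d • x = 0) : x = 0 := by
  obtain ⟨w, z, h⟩ := exists_mul_eq_one_add_two_pow hd N
  have h1 : x = w • (d • x) - z • ((2 ^ N : ℤ) • x) := by
    rw [smul_smul, smul_smul, ← sub_smul, show w * d - z * 2 ^ N = 1 by linarith, one_smul]
  rw [h1, hN, hx]
  simp

theorem ker_zsmul_form (hφ : Function.Injective φ) (r : ℕ) :
    ((2 ^ r : ℤ) • φ).ker = (nsmulAddMonoidHom (α := G) (2 ^ r)).ker := by
  ext x
  rw [AddMonoidHom.mem_ker, AddMonoidHom.mem_ker, AddMonoidHom.smul_apply, ← map_zsmul,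
    map_eq_zero_iff φ hφ, nsmulAddMonoidHom_apply, ← natCast_zsmul]
  norm_num

variable [Fintype G]

/-- The polar form of `2 ^ r * φ(x, x)` is `2 ^ (r + 1) * φ`, whence the shift in the torsion
subgroup. -/
theorem charSum_unary_mul_conj (hs : ∀ x y, φ x y = φ y x) (hφ : Function.Injective φ) (r : ℕ)
    (hne : charSum (fun x => (2 ^ r : ℤ) • φ x x) ≠ 0) :
    charSum (fun x => (2 ^ r : ℤ) • φ x x) * conj (charSum fun x => (2 ^ r : ℤ) • φ x x) =
      Fintype.card G * Nat.card (nsmulAddMonoidHom (α := G) (2 ^ (r + 1))).ker := by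
  rw [← ker_zsmul_form hφ]
  refine charSum_mul_conj_of_ne_zero _ _ (fun z x => ?_) hne
  simp only [map_add, AddMonoidHom.add_apply, AddMonoidHom.smul_apply, smul_add]
  rw [hs x z, pow_succ, mul_smul, ofNat_zsmul, two_nsmul, smul_add]
  abel

theorem charSum_unary_pow_four (s : ℤ) : charSum (fun x => s • φ x x) ^ 4 =
    charSum (matForm φ (s • (1 : Matrix (Fin 4) (Fin 4) ℤ))) := by
  unfold charSum
  rw [Fintype.sum_pow]
  refine Finset.sum_congr rfl fun x _ => ?_
  rw [← circleChar_sum]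
  congr 1
  refine Finset.sum_congr rfl fun i _ => ?_
  rw [Finset.sum_eq_single i] <;> simp +contextual [eq_comm]

/-- The fourth power of a unary Gauss sum is real, since `2 ^ N - 1` is the norm of an integral
quaternion. -/
theorem conj_charSum_unary_pow_four (hs : ∀ x y, φ x y = φ y x) {N : ℕ}
    (hG : ∀ x : G, (2 ^ N : ℤ) • x = 0) (s : ℤ) :
    conj (charSum (fun x => s • φ x x) ^ 4) = charSum (fun x => s • φ x x) ^ 4 := by
  have hG' : ∀ x : G, (2 ^ (N + 1) : ℤ) • x = 0 := fun x => by
    rw [pow_succ', mul_smul, hG, smul_zero]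
  -- The exponent `N + 1` keeps this number odd even when `N = 0`. The matrix `P` below is left
  -- multiplication by the quaternion `a + bi + cj + dk`, so modulo `2 ^ (N + 1)` it carries `s`
  -- times the sum of four squares to its negative.
  obtain ⟨a, b, c, d, h⟩ := Nat.sum_four_squares (2 ^ (N + 1) - 1)
  have h' : (a ^ 2 + b ^ 2 + c ^ 2 + d ^ 2 : ℤ) = 2 ^ (N + 1) - 1 := by
    have : a ^ 2 + b ^ 2 + c ^ 2 + d ^ 2 + 1 = 2 ^ (N + 1) := by
      have := Nat.one_le_two_pow (n := N + 1)
      omega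
    have : (a ^ 2 + b ^ 2 + c ^ 2 + d ^ 2 + 1 : ℤ) = 2 ^ (N + 1) := by exact_mod_cast this
    linarith
  let P : Matrix (Fin 4) (Fin 4) ℤ :=
    !![a, -b, -c, -d; b, a, -d, c; c, d, a, -b; d, -c, b, a]
  have hP : P.transpose * P = (2 ^ (N + 1) - 1 : ℤ) • (1 : Matrix (Fin 4) (Fin 4) ℤ) := by
    rw [← h']
    ext i j
    fin_cases i <;> fin_cases j <;>
      simp [P, Matrix.mul_apply, Fin.sum_univ_four] <;> ring
  have hm : Odd (2 ^ (N + 1) - 1 : ℤ) :=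
    Even.sub_odd (by rw [pow_succ]; exact even_two.mul_left _) odd_one
  have hdet : Odd P.det := by
    have h1 := congrArg Matrix.det hP
    rw [Matrix.det_mul, Matrix.det_transpose, Matrix.det_smul, Matrix.det_one, mul_one] at h1
    exact (Int.odd_mul.1 (h1 ▸ hm.pow)).1
  have h1 := charSum_matForm_conj (φ := φ) (s • (1 : Matrix (Fin 4) (Fin 4) ℤ)) P
    fun x hx => eq_zero_of_odd_zsmul (hG x) hdet hx
  have h2 : QuadCongr (2 ^ (N + 1)) (P.transpose * (s • (1 : Matrix (Fin 4) (Fin 4) ℤ)) * P)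
      ((-s) • (1 : Matrix (Fin 4) (Fin 4) ℤ)) := by
    rw [Matrix.mul_smul, Matrix.mul_one, Matrix.smul_mul, hP]
    constructor
    · intro i
      refine ⟨s, ?_⟩
      simp only [Matrix.smul_apply, Matrix.one_apply_eq, smul_eq_mul]
      ring
    · intro i j hij
      simp only [Matrix.smul_apply, Matrix.one_apply_ne hij, Matrix.one_apply_ne hij.symm,
        smul_eq_mul]
      simp
  rw [matForm_congr hs hG' h2] at h1
  rw [map_pow, conj_charSum]
  simp_rw [← neg_smul]
  rw [charSum_unary_pow_four, charSum_unary_pow_four, h1]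

end

/-- A complex number whose fourth power is real has an eighth root of unity as its phase. -/
theorem exists_eq_norm_mul_exp {z : ℂ} (h0 : z ≠ 0) (h : conj (z ^ 4) = z ^ 4) :
    ∃ n : ℕ, z = ‖z‖ * Complex.exp (2 * Real.pi * Complex.I * ((n : ℤ) / 8)) := by
  have hn : (‖z‖ : ℂ) ≠ 0 := by exact_mod_cast norm_ne_zero_iff.2 h0
  have h1 : (z / ‖z‖) ^ 8 = 1 := by
    have h2 : z ^ 8 = (‖z‖ : ℂ) ^ 8 := by
      calc z ^ 8 = z ^ 4 * conj (z ^ 4) := by rw [h]; ring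
        _ = (z * conj z) ^ 4 := by rw [map_pow]; ring
        _ = _ := by rw [Complex.mul_conj']; ring
    rw [div_pow, h2, div_self (pow_ne_zero _ hn)]
  obtain ⟨n, -, hn'⟩ := (Complex.isPrimitiveRoot_exp 8 (by norm_num)).eq_pow_of_pow_eq_one h1
  refine ⟨n, ?_⟩
  rw [← Complex.exp_nat_mul] at hn'
  rw [eq_div_iff hn] at hn'
  refine hn'.symm.trans ?_
  rw [mul_comm]
  congr 2
  push_cast
  ring

theorem eighthPhase_eq_top_iff (z : ℂ) : eighthPhase z = ⊤ ↔ z = 0 := by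
  unfold eighthPhase
  split_ifs with h <;> simp [h]

theorem eighthPhase_mul {z w : ℂ} (hz : conj (z ^ 4) = z ^ 4) (hw : conj (w ^ 4) = w ^ 4) :
    eighthPhase (z * w) = eighthPhase z + eighthPhase w := by
  rcases eq_or_ne z 0 with rfl | hz0
  · simp [(eighthPhase_eq_top_iff 0).2 rfl]
  rcases eq_or_ne w 0 with rfl | hw0
  · simp [(eighthPhase_eq_top_iff 0).2 rfl]
  obtain ⟨n, hn⟩ := exists_eq_norm_mul_exp hz0 hz
  obtain ⟨m, hm⟩ := exists_eq_norm_mul_exp hw0 hw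
  have h : z * w = ((‖z‖ * ‖w‖ : ℝ) : ℂ) *
      Complex.exp (2 * Real.pi * Complex.I * (((n + m : ℤ) : ℂ) / 8)) := by
    have h1 : (2 * Real.pi * Complex.I * (((n + m : ℤ) : ℂ) / 8)) =
      2 * Real.pi * Complex.I * ((n : ℤ) / 8) + 2 * Real.pi * Complex.I * ((m : ℤ) / 8) := by
      push_cast
      ring
    rw [h1, Complex.exp_add]
    push_cast at hn hm ⊢
    rw [mul_mul_mul_comm, ← hn, ← hm]
  have hz' := norm_pos_iff.2 hz0
  have hw' := norm_pos_iff.2 hw0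
  rw [h, eighthPhase_eq _ (mul_pos hz' hw')]
  rw [hn, eighthPhase_eq _ hz', hm, eighthPhase_eq _ hw']
  push_cast
  rfl

theorem eq_of_eighthPhase_eq {z w : ℂ} (hz : conj (z ^ 4) = z ^ 4) (hw : conj (w ^ 4) = w ^ 4)
    (h : eighthPhase z = eighthPhase w) (hn : z ≠ 0 → w ≠ 0 → ‖z‖ = ‖w‖) : z = w := by
  rcases eq_or_ne z 0 with rfl | hz0
  · exact ((eighthPhase_eq_top_iff w).1 (h ▸ (eighthPhase_eq_top_iff 0).2 rfl)).symm
  rcases eq_or_ne w 0 with rfl | hw0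
  · exact (eighthPhase_eq_top_iff z).1 (h ▸ (eighthPhase_eq_top_iff 0).2 rfl)
  obtain ⟨n, hzn⟩ := exists_eq_norm_mul_exp hz0 hz
  obtain ⟨m, hwm⟩ := exists_eq_norm_mul_exp hw0 hw
  rw [hzn, eighthPhase_eq _ (norm_pos_iff.2 hz0), hwm, eighthPhase_eq _ (norm_pos_iff.2 hw0),
    WithTop.coe_eq_coe, ZMod.intCast_eq_intCast_iff] at h
  obtain ⟨k, hk⟩ := h.dvd
  rw [hwm, hzn, hn hz0 hw0]
  congr 1
  rw [Complex.exp_eq_exp_iff_exists_int]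
  refine ⟨-k, ?_⟩
  have : (m : ℂ) - n = 8 * k := by exact_mod_cast hk
  push_cast
  linear_combination (-(2 * Real.pi * Complex.I) / 8) * this

/-! ### Gauss sums of binary forms with odd middle coefficient. -/

/-- Hensel lifting: the derivative `2 A t + B` is odd, so adding `2 ^ N * w` to a root with value `2
^ N * w` gains a factor 2, provided `N ≥ 1`. -/
theorem exists_even_root_mod_two_pow (A B C : ℤ) (hB : Odd B) (hC : Even C) (N : ℕ) :
    ∃ t : ℤ, Even t ∧ (2 ^ N : ℤ) ∣ A * t ^ 2 + B * t + C := by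
  induction N with
  | zero => exact ⟨0, by simp, by simp⟩
  | succ N ih =>
    rcases N.eq_zero_or_pos with rfl | hN
    · exact ⟨0, by simp, by simpa [even_iff_two_dvd] using hC⟩
    obtain ⟨t, ht, w, hw⟩ := ih
    obtain ⟨M, rfl⟩ := Nat.exists_eq_add_of_lt hN
    have h2 : Even (2 ^ (0 + M + 1) : ℤ) := by rw [pow_succ]; exact even_two.mul_left _
    refine ⟨t + 2 ^ (0 + M + 1) * w, ht.add (h2.mul_right _), ?_⟩
    have he : Even (w + w * (2 * A * t + B) + 2 ^ (0 + M + 1) * w ^ 2 * A) := by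
      refine Even.add ?_ ((h2.mul_right _).mul_right _)
      rw [show w + w * (2 * A * t + B) = w * (2 * A * t + (B + 1)) by ring]
      exact (((even_two.mul_right A).mul_right t).add (hB.add_odd odd_one)).mul_left w
    obtain ⟨v, hv⟩ := even_iff_two_dvd.1 he
    refine ⟨v, ?_⟩
    linear_combination hw + 2 ^ (0 + M + 1) * hv

section

variable {G : Type*} [AddCommGroup G] [Fintype G] {φ : G →+ G →+ AddCircle (1 : ℚ)}

/-- Gauss sums of binary forms are invariant under changes of variables. -/
theorem charSum_binaryForm_conj (hs : ∀ x y, φ x y = φ y x) {N : ℕ}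
    (hG : ∀ x : G, (2 ^ N : ℤ) • x = 0) (m : ℤ) {a b c a' b' c' : ℤ} (p q r s : ℤ)
    (hdet : Odd (p * s - q * r))
    (ha : (2 ^ N : ℤ) ∣ (a * p ^ 2 + b * p * r + c * r ^ 2) - a')
    (hb : (2 ^ N : ℤ) ∣ (2 * a * p * q + b * (p * s + q * r) + 2 * c * r * s) - b')
    (hc : (2 ^ N : ℤ) ∣ (a * q ^ 2 + b * q * s + c * s ^ 2) - c') :
    charSum (binaryForm φ (m * a) (m * b) (m * c)) =
      charSum (binaryForm φ (m * a') (m * b') (m * c')) := by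
  have h1 := charSum_matForm_conj (φ := φ) !![m * a, m * b; 0, m * c] !![p, q; r, s]
    fun x hx => eq_zero_of_odd_zsmul (hG x) (by rwa [Matrix.det_fin_two_of]) hx
  have h2 : QuadCongr (2 ^ N) (!![p, q; r, s].transpose * !![m * a, m * b; 0, m * c] *
      !![p, q; r, s]) !![m * a', m * b'; 0, m * c'] := by
    constructor
    · intro i
      fin_cases i
      · obtain ⟨k, hk⟩ := ha
        refine ⟨m * k, ?_⟩
        simp [Matrix.mul_apply, Fin.sum_univ_two]
        linear_combination m * hk
      · obtain ⟨k, hk⟩ := hc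
        refine ⟨m * k, ?_⟩
        simp [Matrix.mul_apply, Fin.sum_univ_two]
        linear_combination m * hk
    · intro i j hij
      fin_cases i <;> fin_cases j
      · exact absurd rfl hij
      · obtain ⟨k, hk⟩ := hb
        refine ⟨m * k, ?_⟩
        simp [Matrix.mul_apply, Fin.sum_univ_two]
        linear_combination m * hk
      · obtain ⟨k, hk⟩ := hb
        refine ⟨m * k, ?_⟩
        simp [Matrix.mul_apply, Fin.sum_univ_two]
        linear_combination m * hk
      · exact absurd rfl hij
  rw [matForm_congr hs hG h2, charSum_matForm_fin_two hs, charSum_matForm_fin_two hs] at h1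
  simpa using h1.symm

/-- The form represents 0 modulo `2 ^ N` at some `(t, 1)`. Moving this vector to `(0, 1)` kills `c`;
the odd middle coefficient then kills `a` and is scaled to 1. -/
theorem charSum_binaryForm_of_even (hs : ∀ x y, φ x y = φ y x) {N : ℕ}
    (hG : ∀ x : G, (2 ^ N : ℤ) • x = 0) (m : ℤ) {a b c : ℤ} (hb : Odd b) (hc : Even c) :
    charSum (binaryForm φ (m * a) (m * b) (m * c)) =
      charSum (binaryForm φ (m * 0) (m * 1) (m * 0)) := by
  obtain ⟨t, -, hroot⟩ := exists_even_root_mod_two_pow a b c hb hc N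
  have hb' : Odd (2 * a * t + b) := ((even_two.mul_right a).mul_right t).add_odd hb
  obtain ⟨w, z, hw⟩ := exists_mul_eq_one_add_two_pow hb' N
  have hwo : Odd w ∨ N = 0 := by
    rcases N.eq_zero_or_pos with h | h
    · exact Or.inr h
    · refine Or.inl (Int.odd_mul.1 (hw ▸ ?_ : Odd ((2 * a * t + b) * w))).2
      obtain ⟨M, rfl⟩ := Nat.exists_eq_add_of_lt h
      rw [pow_succ]
      exact odd_one.add_even ((even_two.mul_left _).mul_right _)
  rw [charSum_binaryForm_conj hs hG m (a' := a) (b' := 2 * a * t + b) (c' := 0) 1 t 0 1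
    (by simp) (by simp) (by ring_nf; simp) (by convert hroot using 1; ring)]
  rw [charSum_binaryForm_conj hs hG m (a' := 0) (b' := 2 * a * t + b) (c' := 0) 1 0 (-a * w) 1
    (by simp) ⟨-a * z, by linear_combination (-a) * hw⟩ (by ring_nf; simp) (by simp)]
  rcases hwo with hwo | rfl
  · exact charSum_binaryForm_conj hs hG m 1 0 0 w (by simpa using hwo) (by simp)
      ⟨z, by linear_combination hw⟩ (by simp)
  · exact charSum_binaryForm_conj hs hG m 1 0 0 1 (by simp) (by simp) (by simp) (by simp)

theorem charSum_binaryForm_of_odd (hs : ∀ x y, φ x y = φ y x) {N : ℕ}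
    (hG : ∀ x : G, (2 ^ N : ℤ) • x = 0) (m : ℤ) {a b c : ℤ} (ha : Odd a) (hb : Odd b)
    (hc : Odd c) :
    charSum (binaryForm φ (m * a) (m * b) (m * c)) =
      charSum (binaryForm φ (m * 1) (m * 1) (m * 1)) := by
  -- The form takes the value 1 at `(t, 1)`, which normalizes `c`; subtracting `k` times the first
  -- variable from the second then normalizes `b = 2k + 1`.
  obtain ⟨t, -, hroot⟩ := exists_even_root_mod_two_pow a b (c - 1) hb (hc.sub_odd odd_one) N
  rw [charSum_binaryForm_conj hs hG m (a' := a) (b' := 2 * a * t + b) (c' := 1) 1 t 0 1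
    (by simp) (by simp) (by ring_nf; simp) (by convert hroot using 1; ring)]
  have hb' : Odd (2 * a * t + b) := ((even_two.mul_right a).mul_right t).add_odd hb
  generalize 2 * a * t + b = b' at hb'
  obtain ⟨k, rfl⟩ := hb'
  have hd : Odd (a - k - k ^ 2) := by
    rw [sub_sub]
    refine ha.sub_even ?_
    rw [show k + k ^ 2 = k * (k + 1) by ring]
    exact Int.even_mul_succ_self k
  rw [charSum_binaryForm_conj hs hG m (a' := a - k - k ^ 2) (b' := 1) (c' := 1) 1 0 (-k) 1
    (by simp) (by ring_nf; simp) (by ring_nf; simp) (by simp)]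
  generalize a - k - k ^ 2 = d at hd
  -- The vector `(1 - 2s, s)` has polar product 1 with `(0, 1)` for every `s`; this quadratic makes
  -- the form equal to 1 on it.
  obtain ⟨s, -, hs'⟩ := exists_even_root_mod_two_pow (4 * d - 1) (1 - 4 * d) (d - 1)
    (odd_one.sub_even (by rw [show 4 * d = 2 * (2 * d) by ring]; exact even_two.mul_right _))
    (hd.sub_odd odd_one) N
  exact charSum_binaryForm_conj hs hG m (1 - 2 * s) 0 s 1
    (by simpa using odd_one.sub_even (even_two.mul_right s)) (by convert hs' using 1; ring) (by ring_nf; simp) (by simp)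

/-- For fixed `x` the sum over `y` is a character sum, nonzero exactly when `2 ^ r` kills `x`. -/
theorem charSum_hyperbolic (hφ : Function.Injective φ) (r : ℕ) :
    charSum (binaryForm φ (2 ^ r * 0) (2 ^ r * 1) (2 ^ r * 0)) =
      Fintype.card G * Nat.card (nsmulAddMonoidHom (α := G) (2 ^ r)).ker := by
  classical
  rw [← ker_zsmul_form hφ]
  unfold charSum
  rw [Fintype.sum_prod_type]
  have h1 : ∀ x : G, ∑ y, circleChar (binaryForm φ (2 ^ r * 0) (2 ^ r * 1) (2 ^ r * 0) (x, y)) =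
      if ((2 ^ r : ℤ) • φ) x = 0 then (Fintype.card G : ℂ) else 0 := by
    intro x
    rw [← charSum_addMonoidHom]
    simp [binaryForm, charSum]
  simp_rw [h1]
  rw [← Finset.sum_filter, Finset.sum_const, Nat.card_eq_fintype_card, nsmul_eq_mul, mul_comm]
  congr 2
  rw [← Fintype.card_subtype]
  exact Fintype.card_congr (Equiv.refl _)

/-- Gauss sums with a symmetry of order three are congruent modulo `3` to the contribution of
the fixed points. -/
theorem exists_charSum_eq_one_add_three_mul {X : Type*} [Fintype X] (q : X → AddCircle (1 : ℚ))
    (hq : ∀ x, ∃ n : ℕ, 0 < n ∧ n • q x = 0) (f : X → X) (hf : ∀ x, f (f (f x)) = x)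
    (hqf : ∀ x, q (f x) = q x) (x₀ : X) (hfix : ∀ x, f x = x ↔ x = x₀) (h0 : q x₀ = 0) :
    ∃ α : ℂ, IsIntegral ℤ α ∧ charSum q = 1 + 3 * α := by
  classical
  have hcount : ∀ v, ∃ m : ℤ, ((Finset.univ.filter fun x => q x = v).card : ℤ) =
      (if v = 0 then 1 else 0) + 3 * m := by
    intro v
    -- Each level set of `q` is stable under `f`, so its size is congruent modulo 3 to its number of
    -- fixed points.
    let g : Function.End {x // q x = v} := fun x => ⟨f x, (hqf x).trans x.2⟩
    have hg : g ^ 3 ^ 1 = 1 := by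
      funext x
      exact Subtype.ext (hf x)
    have h1 := Equiv.Perm.card_fixedPoints_modEq (p := 3) hg
    have h2 : Fintype.card (Function.fixedPoints g) = if v = 0 then 1 else 0 := by
      split_ifs with hv
      · rw [Fintype.card_eq_one_iff]
        refine ⟨⟨⟨x₀, h0.trans hv.symm⟩, Subtype.ext ((hfix x₀).2 rfl)⟩, ?_⟩
        rintro ⟨x, hx⟩
        exact Subtype.ext (Subtype.ext ((hfix x).1 (congrArg Subtype.val hx)))
      · rw [Fintype.card_eq_zero_iff]
        refine ⟨?_⟩
        rintro ⟨x, hx⟩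
        refine hv ?_
        rw [← x.2, (hfix x).1 (congrArg Subtype.val hx), h0]
    rw [h2, Fintype.card_subtype] at h1
    obtain ⟨m, hm⟩ := (Int.natCast_modEq_iff.2 h1).symm.dvd
    refine ⟨m, ?_⟩
    push_cast at hm
    linarith
  choose m hm using hcount
  refine ⟨∑ v ∈ Finset.univ.image q, (m v : ℂ) * circleChar v, ?_, ?_⟩
  · refine IsIntegral.sum _ fun v hv => IsIntegral.mul ?_ ?_
    · exact isIntegral_algebraMap (R := ℤ) (x := m v)
    · obtain ⟨x, -, rfl⟩ := Finset.mem_image.1 hv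
      obtain ⟨n, hn, hn'⟩ := hq x
      refine IsIntegral.of_pow hn ?_
      rw [← AddChar.map_nsmul_eq_pow, hn', AddChar.map_zero_eq_one]
      exact isIntegral_one
  · unfold charSum
    rw [Finset.sum_comp circleChar q]
    have h3 : ∀ v, (Finset.univ.filter fun x => q x = v).card • circleChar v =
        (if v = 0 then 1 else 0) + 3 * ((m v : ℂ) * circleChar v) := by
      intro v
      have : ((Finset.univ.filter fun x => q x = v).card : ℂ) =
          (if v = 0 then 1 else 0) + 3 * (m v : ℂ) := by exact_mod_cast hm v
      rw [nsmul_eq_mul, this]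
      split_ifs with hv
      · simp [hv]
      · ring
    simp_rw [h3]
    rw [Finset.sum_add_distrib, Finset.mul_sum]
    congr 1
    rw [Finset.sum_ite_eq', if_pos (Finset.mem_image.2 ⟨x₀, Finset.mem_univ _, h0⟩)]

end

theorem not_isIntegral_div_three {n : ℤ} (h : ¬ 3 ∣ n) {α : ℂ} (hα : IsIntegral ℤ α) :
    (n : ℂ) ≠ 3 * α := by
  intro h'
  have h1 : α = algebraMap ℚ ℂ (n / 3) := by
    rw [eq_ratCast]
    push_cast
    rw [h']
    ring
  rw [h1, isIntegral_algebraMap_iff (algebraMap ℚ ℂ).injective] at hα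
  obtain ⟨k, hk⟩ := IsIntegrallyClosed.isIntegral_iff.1 hα
  apply h
  refine ⟨k, ?_⟩
  rw [eq_intCast] at hk
  have : (n : ℚ) = 3 * k := by rw [hk]; ring
  exact_mod_cast this

section

variable {G : Type*} [AddCommGroup G] [Fintype G] {φ : G →+ G →+ AddCircle (1 : ℚ)}

/-- Conjugation negates the form, and `-(x² + x y + y²)` still has odd coefficients, hence the same
Gauss sum. -/
theorem conj_charSum_anisotropic (hs : ∀ x y, φ x y = φ y x) {N : ℕ}
    (hG : ∀ x : G, (2 ^ N : ℤ) • x = 0) (m : ℤ) :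
    conj (charSum (binaryForm φ (m * 1) (m * 1) (m * 1))) =
      charSum (binaryForm φ (m * 1) (m * 1) (m * 1)) := by
  rw [conj_charSum, ← charSum_binaryForm_of_odd hs hG m (a := -1) (b := -1) (c := -1)
    (by decide) (by decide) (by decide)]
  congr 1
  funext z
  simp only [binaryForm, mul_neg, mul_one, neg_smul]
  abel

/-- The form `x² + x y + y²` is invariant under `(x, y) ↦ (-x - y, x)`, of order three. A fixed
point has `x = y` and `3x = 0`, hence is zero. -/
theorem exists_charSum_anisotropic_eq (hs : ∀ x y, φ x y = φ y x) {N : ℕ}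
    (hG : ∀ x : G, (2 ^ N : ℤ) • x = 0) (m : ℤ) :
    ∃ α : ℂ, IsIntegral ℤ α ∧
      charSum (binaryForm φ (m * 1) (m * 1) (m * 1)) = 1 + 3 * α := by
  refine exists_charSum_eq_one_add_three_mul _ (fun x => ⟨Fintype.card (G × G),
    Fintype.card_pos, ?_⟩) (fun z => (-z.1 - z.2, z.1)) (fun z => ?_) (fun z => ?_) 0
    (fun z => ⟨fun h => ?_, ?_⟩) (by simp [binaryForm])
  · have h : ∀ y z : G, Fintype.card G • φ y z = 0 := card_nsmul_form rfl φ
    rw [Fintype.card_prod, mul_smul]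
    simp only [binaryForm, smul_add, smul_comm (Fintype.card G), h, smul_zero, add_zero]
  · ext
    · simp only
      abel
    · simp only
      abel
  · simp only [binaryForm, map_sub, map_neg, AddMonoidHom.sub_apply, AddMonoidHom.neg_apply,
      hs z.2 z.1, smul_sub, smul_neg]
    abel
  · have h1 : -z.1 - z.2 = z.1 := congrArg Prod.fst h
    have h2 : z.1 = z.2 := congrArg Prod.snd h
    rw [← h2] at h1
    have h3 : z.1 = 0 := by
      refine eq_zero_of_odd_zsmul (hG z.1) (d := 3) (by decide) ?_
      have : (3 : ℤ) • z.1 = z.1 - (-z.1 - z.1) := by abel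
      rw [this, h1, sub_self]
    exact Prod.ext h3 (h2 ▸ h3)
  · rintro rfl
    simp

theorem charSum_anisotropic_mul_self (hs : ∀ x y, φ x y = φ y x) (hφ : Function.Injective φ)
    {N : ℕ} (hG : ∀ x : G, (2 ^ N : ℤ) • x = 0) (r : ℕ) :
    charSum (binaryForm φ (2 ^ r * 1) (2 ^ r * 1) (2 ^ r * 1)) *
        charSum (binaryForm φ (2 ^ r * 1) (2 ^ r * 1) (2 ^ r * 1)) =
      (Fintype.card G * Nat.card (nsmulAddMonoidHom (α := G) (2 ^ r)).ker) *
        (Fintype.card G * Nat.card (nsmulAddMonoidHom (α := G) (2 ^ r)).ker) := by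
  have hne : charSum (binaryForm φ (2 ^ r * 1) (2 ^ r * 1) (2 ^ r * 1)) ≠ 0 := by
    intro h0
    obtain ⟨α, hα, h⟩ := exists_charSum_anisotropic_eq hs hG (2 ^ r)
    refine not_isIntegral_div_three (n := 1) (by norm_num) hα.neg ?_
    rw [h0] at h
    push_cast
    linear_combination -h
  let b : G × G →+ G × G →+ AddCircle (1 : ℚ) := AddMonoidHom.mk'
    (fun z => (((2 ^ r : ℤ) • φ) (z.1 + z.1 + z.2)).coprod
      (((2 ^ r : ℤ) • φ) (z.1 + (z.2 + z.2)))) (by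
      intro z w
      ext x
      simp
      abel)
  have hb : ∀ z x, binaryForm φ (2 ^ r * 1) (2 ^ r * 1) (2 ^ r * 1) (z + x) =
      binaryForm φ (2 ^ r * 1) (2 ^ r * 1) (2 ^ r * 1) z +
        binaryForm φ (2 ^ r * 1) (2 ^ r * 1) (2 ^ r * 1) x + b z x := by
    intro z x
    simp only [binaryForm, b, AddMonoidHom.mk'_apply, AddMonoidHom.coprod_apply, mul_one,
      Prod.fst_add, Prod.snd_add, map_add, AddMonoidHom.add_apply, AddMonoidHom.smul_apply,
      smul_add, hs x.1 z.1, hs x.1 z.2, hs x.2 z.2]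
    abel
  -- The polar matrix `[[2, 1], [1, 2]]` has determinant 3, which is invertible on `G`.
  have hker : b.ker = (nsmulAddMonoidHom (α := G) (2 ^ r)).ker.prod
      (nsmulAddMonoidHom (α := G) (2 ^ r)).ker := by
    rw [← ker_zsmul_form hφ]
    ext z
    rw [AddSubgroup.mem_prod, AddMonoidHom.mem_ker, AddMonoidHom.mem_ker, AddMonoidHom.mem_ker]
    constructor
    · intro h
      have h1 : ((2 ^ r : ℤ) • φ) (z.1 + z.1 + z.2) = 0 := by
        ext x
        simpa [b] using DFunLike.congr_fun h (x, 0)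
      have h2 : ((2 ^ r : ℤ) • φ) (z.1 + (z.2 + z.2)) = 0 := by
        ext x
        simpa [b] using DFunLike.congr_fun h (0, x)
      have hodd : ∀ y : G, (3 : ℤ) • ((2 ^ r : ℤ) • φ) y = 0 → ((2 ^ r : ℤ) • φ) y = 0 := by
        intro y hy
        refine eq_zero_of_odd_zsmul (N := N) ?_ (d := 3) (by decide) hy
        rw [← map_zsmul, hG, map_zero]
      constructor
      · apply hodd
        have : (3 : ℤ) • z.1 = (z.1 + z.1 + z.2) + (z.1 + z.1 + z.2) - (z.1 + (z.2 + z.2)) := by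
          abel
        rw [← map_zsmul, this, map_sub, map_add, h1, h2]
        simp
      · apply hodd
        have : (3 : ℤ) • z.2 = (z.1 + (z.2 + z.2)) + (z.1 + (z.2 + z.2)) - (z.1 + z.1 + z.2) := by
          abel
        rw [← map_zsmul, this, map_sub, map_add, h1, h2]
        simp
    · rintro ⟨h1, h2⟩
      ext x
      simp only [b, AddMonoidHom.mk'_apply, map_add, h1, h2]
      simp
  have h := charSum_mul_conj_of_ne_zero _ b hb hne
  rw [conj_charSum_anisotropic hs hG, hker,
    Nat.card_congr (AddSubgroup.prodEquiv _ _).toEquiv, Nat.card_prod, Fintype.card_prod] at h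
  rw [h]
  push_cast
  ring

end

/-! ### Comparing the Gauss sums of two pairings. -/

section

variable {G H : Type*} [AddCommGroup G] [AddCommGroup H] [Fintype G] [Fintype H]
  {φ : G →+ G →+ AddCircle (1 : ℚ)} {ψ : H →+ H →+ AddCircle (1 : ℚ)}

/-- Both sums are plus or minus the same integer `c` prime to 3. Both are 1 modulo 3, so opposite
signs would make `2 * c` divisible by 3. -/
theorem charSum_anisotropic_eq (hφs : ∀ x y, φ x y = φ y x) (hψs : ∀ x y, ψ x y = ψ y x)
    (hφ : Function.Injective φ) (hψ : Function.Injective ψ) {N : ℕ}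
    (hG : ∀ x : G, (2 ^ N : ℤ) • x = 0) (hH : ∀ x : H, (2 ^ N : ℤ) • x = 0)
    (hcard : Fintype.card G = Fintype.card H) (h3 : ¬ 3 ∣ Fintype.card G) (r : ℕ)
    (hker : Nat.card (nsmulAddMonoidHom (α := G) (2 ^ r)).ker =
      Nat.card (nsmulAddMonoidHom (α := H) (2 ^ r)).ker) :
    charSum (binaryForm φ (2 ^ r * 1) (2 ^ r * 1) (2 ^ r * 1)) =
      charSum (binaryForm ψ (2 ^ r * 1) (2 ^ r * 1) (2 ^ r * 1)) := by
  have h1 := charSum_anisotropic_mul_self hφs hφ hG r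
  have h2 := charSum_anisotropic_mul_self hψs hψ hH r
  obtain ⟨α, hα, hα'⟩ := exists_charSum_anisotropic_eq hφs hG (2 ^ r)
  obtain ⟨β, hβ, hβ'⟩ := exists_charSum_anisotropic_eq hψs hH (2 ^ r)
  rw [← hcard, ← hker] at h2
  have h4 : ¬ (3 : ℤ) ∣ 2 * ((Fintype.card G * Nat.card
      (nsmulAddMonoidHom (α := G) (2 ^ r)).ker : ℕ) : ℤ) := by
    have hp : Nat.Prime 3 := Nat.prime_three
    intro h
    have h' : 3 ∣ 2 * (Fintype.card G * Nat.card (nsmulAddMonoidHom (α := G) (2 ^ r)).ker) := by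
      exact_mod_cast h
    rcases hp.dvd_mul.1 h' with h' | h'
    · norm_num at h'
    · rcases hp.dvd_mul.1 h' with h' | h'
      · exact h3 h'
      · refine h3 (h'.trans ?_)
        rw [← Nat.card_eq_fintype_card]
        exact AddSubgroup.card_addSubgroup_dvd_card _
  rcases mul_self_eq_mul_self_iff.1 (h1.trans h2.symm) with h | h
  · exact h
  exfalso
  rcases mul_self_eq_mul_self_iff.1 h1 with h5 | h5
  · refine not_isIntegral_div_three h4 (hα.sub hβ) ?_
    push_cast
    linear_combination -2 * h5 + h + hα' - hβ'
  · refine not_isIntegral_div_three h4 (hβ.sub hα) ?_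
    push_cast
    linear_combination 2 * h5 - h - hα' + hβ'

theorem charSum_unary_zsmul_eq {N : ℕ} (hG : ∀ x : G, (2 ^ N : ℤ) • x = 0)
    (hH : ∀ x : H, (2 ^ N : ℤ) • x = 0) (r : ℕ)
    (h : charSum (fun x => (2 ^ r : ℤ) • φ x x) = charSum fun x => (2 ^ r : ℤ) • ψ x x)
    {u : ℤ} (hu : Odd u) :
    charSum (fun x => (2 ^ r * u) • φ x x) = charSum fun x => (2 ^ r * u) • ψ x x := by
  -- The Galois action needs a natural exponent; reducing modulo `2 ^ (N + 1)` keeps it odd even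
  -- when `N = 0`.
  obtain ⟨v, hv⟩ : ∃ v : ℕ, (v : ℤ) = u % 2 ^ (N + 1) :=
    ⟨(u % 2 ^ (N + 1)).toNat, Int.toNat_of_nonneg (Int.emod_nonneg _ (by positivity))⟩
  have hd : (2 ^ (N + 1) : ℤ) ∣ u - v := hv ▸ Int.dvd_self_sub_emod
  have hvo : Odd v := by
    obtain ⟨k, hk⟩ := hd
    have : (v : ℤ) = u - 2 * (2 ^ N * k) := by rw [← mul_assoc, ← pow_succ', ← hk]; ring
    have : Odd (v : ℤ) := this ▸ hu.sub_even (even_two.mul_right _)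
    exact_mod_cast this
  have hd' : (2 ^ N : ℤ) ∣ 2 ^ r * u - v * 2 ^ r := by
    rw [mul_comm (v : ℤ), ← mul_sub]
    exact ((pow_dvd_pow 2 N.le_succ).trans hd).mul_left _
  have h1 := charSum_nsmul_congr (n := 2 ^ N) _ _
    (fun x => by
      rw [← natCast_zsmul, smul_comm, ← map_zsmul, Nat.cast_pow, Nat.cast_ofNat, hG, map_zero,
        smul_zero])
    (fun x => by
      rw [← natCast_zsmul, smul_comm, ← map_zsmul, Nat.cast_pow, Nat.cast_ofNat, hH, map_zero,
        smul_zero]) h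
    (u := v) (Nat.Coprime.pow_right _ (Nat.coprime_two_right.2 hvo))
  simp_rw [zsmul_form_eq_of_dvd hG hd', zsmul_form_eq_of_dvd hH hd', mul_smul, natCast_zsmul]
  exact h1

end

/-! ### Ranks and torsion of finite abelian 2-groups. -/

section rank

theorem exists_addEquiv_pi_zmod {G : Type*} [AddCommGroup G] [Fintype G]
    (hG : IsPGroup 2 (Multiplicative G)) : ∃ (ι : Type) (_ : Fintype ι) (e : ι → ℕ),
      Nonempty (G ≃+ ((i : ι) → ZMod (2 ^ e i))) := by
  classical
  obtain ⟨ι, _, p, hp, e, ⟨f⟩⟩ := AddCommGroup.equiv_directSum_zmod_of_finite G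
  have f' : G ≃+ ((i : ι) → ZMod (p i ^ e i)) := f.trans (DirectSum.addEquivProd _)
  obtain ⟨n, hn⟩ := IsPGroup.iff_card.1 hG
  have hcard : ∏ i, p i ^ e i = 2 ^ n := by
    rw [← hn, Nat.card_congr Multiplicative.toAdd, Nat.card_congr f'.toEquiv, Nat.card_pi]
    simp
  -- The structure theorem may list trivial factors at other primes; they are recorded as `2 ^ 0`.
  have h : ∀ i, p i ^ e i = 2 ^ (if p i = 2 then e i else 0) := by
    intro i
    split_ifs with h
    · rw [h]
    · have h1 : p i ^ e i ∣ 2 ^ n := hcard ▸ Finset.dvd_prod_of_mem _ (Finset.mem_univ i)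
      rcases Nat.eq_zero_or_pos (e i) with h0 | h0
      · rw [h0, pow_zero, pow_zero]
      · exact absurd ((Nat.prime_dvd_prime_iff_eq (hp i) Nat.prime_two).1
          ((hp i).dvd_of_dvd_pow ((dvd_pow_self _ h0.ne').trans h1))) h
  refine ⟨ι, inferInstance, fun i => if p i = 2 then e i else 0, ⟨f'.trans ?_⟩⟩
  exact AddEquiv.piCongrRight fun i => (ZMod.ringEquivCongr (h i)).toAddEquiv

/-- The ranks do not count trivial factors, so `f` must vanish at exponent 0. -/
theorem sum_comp_eq_of_card_eq {ι κ : Type*} [Fintype ι] [Fintype κ] (e : ι → ℕ) (e' : κ → ℕ)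
    (h : ∀ k : ℕ+, (Finset.univ.filter fun i => e i = k).card =
      (Finset.univ.filter fun i => e' i = k).card) (f : ℕ → ℕ) (hf : f 0 = 0) :
    ∑ i, f (e i) = ∑ i, f (e' i) := by
  let s := Finset.univ.image e ∪ Finset.univ.image e'
  have h1 : ∑ i, f (e i) = ∑ k ∈ s, (Finset.univ.filter fun i => e i = k).card * f k := by
    rw [← Finset.sum_fiberwise_of_maps_to (s := Finset.univ) (t := s) (g := e)
      (fun i _ => Finset.mem_union_left _ (Finset.mem_image_of_mem e (Finset.mem_univ i)))]
    refine Finset.sum_congr rfl fun k _ => ?_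
    rw [Finset.sum_congr rfl (g := fun _ => f k) (by simp +contextual), Finset.sum_const,
      smul_eq_mul]
  have h2 : ∑ i, f (e' i) = ∑ k ∈ s, (Finset.univ.filter fun i => e' i = k).card * f k := by
    rw [← Finset.sum_fiberwise_of_maps_to (s := Finset.univ) (t := s) (g := e')
      (fun i _ => Finset.mem_union_right _ (Finset.mem_image_of_mem e' (Finset.mem_univ i)))]
    refine Finset.sum_congr rfl fun k _ => ?_
    rw [Finset.sum_congr rfl (g := fun _ => f k) (by simp +contextual), Finset.sum_const,
      smul_eq_mul]
  rw [h1, h2]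
  refine Finset.sum_congr rfl fun k _ => ?_
  rcases k.eq_zero_or_pos with rfl | hk
  · simp [hf]
  · rw [show (Finset.univ.filter fun i => e i = k).card =
      (Finset.univ.filter fun i => e' i = k).card from h ⟨k, hk⟩]

theorem card_range_nsmul_eq {G H : Type*} [AddCommGroup G] [AddCommGroup H] [Fintype G]
    [Fintype H] (hG : IsPGroup 2 (Multiplicative G)) (hH : IsPGroup 2 (Multiplicative H))
    (h : ∀ k, homogeneousRank G k = homogeneousRank H k) (j : ℕ) :
    Nat.card (nsmulAddMonoidHom (α := G) (2 ^ j)).range =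
      Nat.card (nsmulAddMonoidHom (α := H) (2 ^ j)).range := by
  obtain ⟨ι, _, e, ⟨f⟩⟩ := exists_addEquiv_pi_zmod hG
  obtain ⟨κ, _, e', ⟨f'⟩⟩ := exists_addEquiv_pi_zmod hH
  rw [card_range_nsmul_pi e f, card_range_nsmul_pi e' f']
  congr 1
  refine sum_comp_eq_of_card_eq e e' (fun k => ?_) (fun n => n - j) (Nat.zero_sub j)
  rw [← homogeneousRank_eq_card e f, ← homogeneousRank_eq_card e' f', h]

theorem card_eq_of_homogeneousRank_eq {G H : Type*} [AddCommGroup G] [AddCommGroup H] [Fintype G]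
    [Fintype H] (hG : IsPGroup 2 (Multiplicative G)) (hH : IsPGroup 2 (Multiplicative H))
    (h : ∀ k, homogeneousRank G k = homogeneousRank H k) :
    Fintype.card G = Fintype.card H := by
  have h1 := card_range_nsmul_eq hG hH h 0
  rw [AddMonoidHom.range_eq_top.2 fun x => ⟨x, by simp⟩,
    AddMonoidHom.range_eq_top.2 fun x => ⟨x, by simp⟩] at h1
  simpa [Nat.card_eq_fintype_card] using h1

theorem card_ker_nsmul_eq {G H : Type*} [AddCommGroup G] [AddCommGroup H] [Fintype G]
    [Fintype H] (hG : IsPGroup 2 (Multiplicative G)) (hH : IsPGroup 2 (Multiplicative H))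
    (h : ∀ k, homogeneousRank G k = homogeneousRank H k) (j : ℕ) :
    Nat.card (nsmulAddMonoidHom (α := G) (2 ^ j)).ker =
      Nat.card (nsmulAddMonoidHom (α := H) (2 ^ j)).ker := by
  have h1 := AddSubgroup.card_mul_index (nsmulAddMonoidHom (α := G) (2 ^ j)).ker
  have h2 := AddSubgroup.card_mul_index (nsmulAddMonoidHom (α := H) (2 ^ j)).ker
  rw [AddSubgroup.index_ker, Nat.card_eq_fintype_card (α := G)] at h1
  rw [AddSubgroup.index_ker, Nat.card_eq_fintype_card (α := H),
    ← card_eq_of_homogeneousRank_eq hG hH h, ← card_range_nsmul_eq hG hH h, ← h1] at h2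
  exact (Nat.eq_of_mul_eq_mul_right Nat.card_pos h2).symm

theorem homogeneousRank_prod {G H : Type*} [AddCommGroup G] [AddCommGroup H] [Fintype G]
    [Fintype H] (hG : IsPGroup 2 (Multiplicative G)) (hH : IsPGroup 2 (Multiplicative H))
    (k : ℕ+) : homogeneousRank (G × H) k = homogeneousRank G k + homogeneousRank H k := by
  obtain ⟨ι, _, e, ⟨f⟩⟩ := exists_addEquiv_pi_zmod hG
  obtain ⟨κ, _, e', ⟨f'⟩⟩ := exists_addEquiv_pi_zmod hH
  let F : G × H ≃+ ((i : ι ⊕ κ) → ZMod (2 ^ Sum.elim e e' i)) := (f.prodCongr f').trans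
    (LinearEquiv.sumPiEquivProdPi ℤ ι κ fun i => ZMod (2 ^ Sum.elim e e' i)).symm.toAddEquiv
  rw [homogeneousRank_eq_card _ F, homogeneousRank_eq_card e f, homogeneousRank_eq_card e' f',
    Finset.card_filter, Finset.card_filter, Finset.card_filter, Fintype.sum_sum_type]
  rfl

theorem homogeneousRank_congr {G H : Type*} [AddCommGroup G] [AddCommGroup H] [Fintype G]
    (hG : IsPGroup 2 (Multiplicative G)) (e : G ≃+ H) (k : ℕ+) :
    homogeneousRank G k = homogeneousRank H k := by
  obtain ⟨ι, _, n, ⟨f⟩⟩ := exists_addEquiv_pi_zmod hG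
  rw [homogeneousRank_eq_card n f, homogeneousRank_eq_card n (e.symm.trans f)]

theorem exists_two_pow_zsmul_eq_zero {G : Type*} [AddCommGroup G] [Fintype G]
    (hG : IsPGroup 2 (Multiplicative G)) : ∃ N : ℕ, Fintype.card G = 2 ^ N ∧
      ∀ x : G, (2 ^ N : ℤ) • x = 0 := by
  obtain ⟨N, hN⟩ := IsPGroup.iff_card.1 hG
  rw [Nat.card_congr Multiplicative.toAdd, Nat.card_eq_fintype_card] at hN
  refine ⟨N, hN, fun x => ?_⟩
  have := card_nsmul_eq_zero (x := x)
  rw [hN, ← natCast_zsmul] at this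
  exact_mod_cast this

end rank

/-! ### Additivity of the invariants and the classification. -/

namespace LinkingPairing

variable {G H : Type*} [AddCommGroup G] [Fintype G] [AddCommGroup H] [Fintype H]

theorem gaussSum_eq_charSum (a : LinkingPairing G) (k : ℕ+) :
    a.gaussSum k = charSum fun x => (2 ^ ((k : ℕ) - 1) : ℤ) • a.form x x :=
  Finset.sum_congr rfl fun x _ => gaussTerm_eq_circleChar k (a.form x x)

theorem conj_gaussSum_pow_four (hG : IsPGroup 2 (Multiplicative G)) (a : LinkingPairing G)
    (k : ℕ+) : conj (a.gaussSum k ^ 4) = a.gaussSum k ^ 4 := by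
  obtain ⟨N, -, hN⟩ := exists_two_pow_zsmul_eq_zero hG
  rw [gaussSum_eq_charSum]
  exact conj_charSum_unary_pow_four a.symm hN _

theorem gaussSum_orthogonalSum (a : LinkingPairing G) (b : LinkingPairing H) (k : ℕ+) :
    (a.orthogonalSum b).gaussSum k = a.gaussSum k * b.gaussSum k := by
  simp only [gaussSum_eq_charSum, orthogonalSum_form, smul_add]
  exact charSum_prod (fun x => (2 ^ ((k : ℕ) - 1) : ℤ) • a.form x x)
    fun y => (2 ^ ((k : ℕ) - 1) : ℤ) • b.form y y

theorem sigma_orthogonalSum (hG : IsPGroup 2 (Multiplicative G))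
    (hH : IsPGroup 2 (Multiplicative H)) (a : LinkingPairing G) (b : LinkingPairing H) (k : ℕ+) :
    (a.orthogonalSum b).sigma k = a.sigma k + b.sigma k := by
  rw [sigma, gaussSum_orthogonalSum, eighthPhase_mul (a.conj_gaussSum_pow_four hG k)
    (b.conj_gaussSum_pow_four hH k)]
  rfl

theorem rho_orthogonalSum (hG : IsPGroup 2 (Multiplicative G))
    (hH : IsPGroup 2 (Multiplicative H)) (a : LinkingPairing G) (b : LinkingPairing H) (k : ℕ+) :
    (a.orthogonalSum b).rho k = a.rho k + b.rho k :=
  homogeneousRank_prod hG hH k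

theorem Isomorphic.rho_eq {G H : Type*} [AddCommGroup G] [Fintype G] [AddCommGroup H]
    (hG : IsPGroup 2 (Multiplicative G)) {a : LinkingPairing G}
    {b : LinkingPairing H} (h : a.Isomorphic b) (k : ℕ+) : a.rho k = b.rho k := by
  obtain ⟨e, -⟩ := h
  exact homogeneousRank_congr hG e k

theorem Isomorphic.sigma_eq {a : LinkingPairing G} {b : LinkingPairing H} (h : a.Isomorphic b)
    (k : ℕ+) : a.sigma k = b.sigma k := by
  obtain ⟨e, he⟩ := h
  unfold sigma
  rw [gaussSum_eq_charSum, gaussSum_eq_charSum]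
  congr 1
  exact charSum_congr_equiv e.toEquiv fun x => by simp [he]

/-- `σ_k` decides vanishing and phase; a nonzero modulus depends only on `|G|` and the order of the
`2 ^ k`-torsion, which the ranks determine. -/
theorem gaussSum_eq_of_rho_eq_of_sigma_eq (hG : IsPGroup 2 (Multiplicative G))
    (hH : IsPGroup 2 (Multiplicative H)) (a : LinkingPairing G) (b : LinkingPairing H)
    (hrho : ∀ k, a.rho k = b.rho k) (k : ℕ+) (hsigma : a.sigma k = b.sigma k) :
    a.gaussSum k = b.gaussSum k := by
  refine eq_of_eighthPhase_eq (a.conj_gaussSum_pow_four hG k) (b.conj_gaussSum_pow_four hH k)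
    hsigma fun ha hb => ?_
  rw [gaussSum_eq_charSum] at ha hb ⊢
  rw [gaussSum_eq_charSum]
  have h1 := charSum_unary_mul_conj a.symm a.bijective_adjoint.1 _ ha
  have h2 := charSum_unary_mul_conj b.symm b.bijective_adjoint.1 _ hb
  rw [← card_eq_of_homogeneousRank_eq hG hH hrho, ← card_ker_nsmul_eq hG hH hrho, ← h1,
    Complex.mul_conj', Complex.mul_conj'] at h2
  exact ((pow_left_inj₀ (norm_nonneg _) (norm_nonneg _) two_ne_zero).1
    (by exact_mod_cast h2)).symm

/-- **Kawauchi–Kojima**: the invariants `ρ_k` and `σ_k` classify the linking pairings on finite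
abelian `2`-groups. -/
theorem isomorphic_of_rho_eq_of_sigma_eq (hG : IsPGroup 2 (Multiplicative G))
    (hH : IsPGroup 2 (Multiplicative H)) (a : LinkingPairing G) (b : LinkingPairing H)
    (hrho : ∀ k, a.rho k = b.rho k) (hsigma : ∀ k, a.sigma k = b.sigma k) :
    a.Isomorphic b := by
  have hcard := card_eq_of_homogeneousRank_eq hG hH hrho
  have hker := card_ker_nsmul_eq hG hH hrho
  obtain ⟨N, hcN, hN⟩ := exists_two_pow_zsmul_eq_zero hG
  have hN' : ∀ x : H, (2 ^ N : ℤ) • x = 0 := by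
    obtain ⟨M, hcM, hM⟩ := exists_two_pow_zsmul_eq_zero hH
    rwa [Nat.pow_right_injective le_rfl (hcM.symm.trans (hcard.symm.trans hcN))] at hM
  have h3 : ¬ 3 ∣ Fintype.card G := fun h => by
    rw [hcN] at h
    have := Nat.prime_three.dvd_of_dvd_pow h
    norm_num at this
  refine exists_addEquiv_of_charSum_eq a.bijective_adjoint.1 b.bijective_adjoint.1 hcard
    fun n A => charSum_matForm_eq a.symm b.symm hN hN' hcard (fun r u hu => ?_)
      (fun r x y z hy => ?_) (Fin n) A
  · refine charSum_unary_zsmul_eq hN hN' r ?_ hu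
    have := gaussSum_eq_of_rho_eq_of_sigma_eq hG hH a b hrho ⟨r + 1, r.succ_pos⟩ (hsigma _)
    exact ((gaussSum_eq_charSum a _).symm.trans this).trans (gaussSum_eq_charSum b _)
  · have hyp : charSum (binaryForm a.form (2 ^ r * 0) (2 ^ r * 1) (2 ^ r * 0)) =
        charSum (binaryForm b.form (2 ^ r * 0) (2 ^ r * 1) (2 ^ r * 0)) := by
      rw [charSum_hyperbolic a.bijective_adjoint.1, charSum_hyperbolic b.bijective_adjoint.1,
        hcard, hker]
    rcases Int.even_or_odd z with hz | hz
    · rw [charSum_binaryForm_of_even a.symm hN _ hy hz,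
        charSum_binaryForm_of_even b.symm hN' _ hy hz, hyp]
    rcases Int.even_or_odd x with hx | hx
    -- Exchanging the two variables puts the even coefficient last.
    · rw [charSum_binaryForm_conj a.symm hN _ (a' := z) (b' := y) (c' := x) 0 1 1 0
          (by decide) (by simp) (by simp) (by simp),
        charSum_binaryForm_conj b.symm hN' _ (a' := z) (b' := y) (c' := x) 0 1 1 0
          (by decide) (by simp) (by simp) (by simp),
        charSum_binaryForm_of_even a.symm hN _ hy hx,
        charSum_binaryForm_of_even b.symm hN' _ hy hx, hyp]
    · rw [charSum_binaryForm_of_odd a.symm hN _ hx hy hz,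
        charSum_binaryForm_of_odd b.symm hN' _ hx hy hz]
      exact charSum_anisotropic_eq a.symm b.symm a.bijective_adjoint.1 b.bijective_adjoint.1
        hN hN' hcard h3 r (hker r)

end LinkingPairing

/-! ### The criterion for orthogonal summands. -/

theorem mainTheorem3 {G H : Type*} [AddCommGroup G] [Fintype G] [AddCommGroup H] [Fintype H]
    (hG : IsPGroup 2 (Multiplicative G)) (hH : IsPGroup 2 (Multiplicative H))
    (a : LinkingPairing G) (b : LinkingPairing H) :
    b.IsOrthogonalSummand a ↔
      (∀ k : ℕ+, b.rho k ≤ a.rho k) ∧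
      (∀ k : ℕ+, b.sigma k = ⊤ → a.sigma k = ⊤) ∧
      ∃ T ∈ differenceTableaux a b, T.IsAdmissible := by
  constructor
  · rintro ⟨K, _, _, c, hiso⟩
    -- The complement embeds in `G`, so it is again a 2-group.
    have hK : IsPGroup 2 (Multiplicative K) := by
      obtain ⟨e, -⟩ := hiso
      exact hG.of_injective (AddMonoidHom.toMultiplicative
        ((e.symm : H × K →+ G).comp (AddMonoidHom.inr H K)))
        fun x y h => congrArg Prod.snd (e.symm.injective h)
    have hrho : ∀ k, a.rho k = b.rho k + c.rho k := fun k =>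
      (hiso.rho_eq hG k).trans (LinkingPairing.rho_orthogonalSum hH hK b c k)
    have hsigma : ∀ k, a.sigma k = b.sigma k + c.sigma k := fun k =>
      (hiso.sigma_eq k).trans (LinkingPairing.sigma_orthogonalSum hH hK b c k)
    refine ⟨fun k => hrho k ▸ Nat.le_add_right _ _, fun k hk => by rw [hsigma, hk, WithTop.top_add],
      _, ⟨fun k => c.sigma k, rfl⟩, K, inferInstance, inferInstance, c, hK, fun k => ?_⟩
    refine Prod.ext ?_ ?_
    · simp [differenceTableau, hrho]
    · unfold differenceTableau
      split_ifs with h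
      · rfl
      · obtain ⟨u, hu⟩ := WithTop.ne_top_iff_exists.1 h
        simp only [ExtendedZMod8.subFinite, hsigma, ← hu, WithTop.untop_coe]
        rw [add_right_comm, ← WithTop.coe_add, add_neg_cancel, WithTop.coe_zero, zero_add]
  · rintro ⟨hrho, htop, _, ⟨s, rfl⟩, K, _, _, c, hK, hT⟩
    refine ⟨K, inferInstance, inferInstance, c, ?_⟩
    have hHK : IsPGroup 2 (Multiplicative (H × K)) := by
      rw [IsPGroup.iff_card] at hH hK ⊢
      obtain ⟨m, hm⟩ := hH
      obtain ⟨n, hn⟩ := hK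
      refine ⟨m + n, ?_⟩
      rw [Nat.card_congr Multiplicative.toAdd] at hm hn ⊢
      rw [Nat.card_prod, hm, hn, pow_add]
    refine LinkingPairing.isomorphic_of_rho_eq_of_sigma_eq hG hHK a _ (fun k => ?_) fun k => ?_
    · have h1 : a.rho k - b.rho k = c.rho k := congrArg Prod.fst (hT k)
      rw [LinkingPairing.rho_orthogonalSum hH hK, ← h1, Nat.add_sub_cancel' (hrho k)]
    · rw [LinkingPairing.sigma_orthogonalSum hH hK]
      by_cases h : b.sigma k = ⊤
      · rw [h, WithTop.top_add, htop k h]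
      · have h1 : _ = c.sigma k := congrArg Prod.snd (hT k)
        simp only [differenceTableau, dif_neg h] at h1
        rw [← h1]
        obtain ⟨u, hu⟩ := WithTop.ne_top_iff_exists.1 h
        simp only [ExtendedZMod8.subFinite, ← hu, WithTop.untop_coe]
        rw [add_left_comm, ← WithTop.coe_add, add_neg_cancel, WithTop.coe_zero, add_zero]
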